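/- Let $G$ be a compact Lie group whose identity component $\mathbb{T}$ is a 2-torus and whose component group $W=G/\mathbb{T}$ has order 2, such that the rational representation $H_1(\mathbb{T};\mathbb{Q})$ of $W$ is isomorphic to $\mathbb{Q}\oplus\tilde{\mathbb{Q}}$ (the trivial plus the sign representation). Let $Z$ and $\tilde T$ be the images under the exponential map of the $+1$ and the $-1$ eigenspace of $W$ on the Lie algebra $L\mathbb{T}$. All subgroups considered are closed. A subgroup $H$ is full if it maps onto $W$, and $\mathcal{V}$ is the space of conjugacy classes of full subgroups, a subspace of the space $\mathrm{Sub}(G)/G$ of all conjugacy classes of subgroups with the Zariski topology: a set is closed if it is closed in the quotient of the Hausdorff metric topology and is closed under passage to cotoral subgroups. ($K$ is cotoral in $H$ if $K$ is normal in $H$ with $H/K$ a torus, possibly trivial; a class is cotoral in another one if this holds for some representatives.) A Thomason subset of a space is a union of closed subsets with quasi-compact complements. The Thomason height of a point of $\mathcal{V}$ is the $n$ for which the point is removed at step $n$ $(n=0,1,2,\dots)$ of the following process: at each step, remove from the remaining subspace all points $x$ for which $\{x\}$ is a Thomason subset of that subspace. The Thomason height of a full subgroup is that of its conjugacy class. Then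 the following hold for full subgroups of $G$. 1. The Thomason height of every full subgroup $H$ is equal to the dimension of $H$. 2. A full subgroup $H$ has finite Weyl group $N_G(H)/H$ if and only if $Z\subseteq H$. 3. The set of full subgroups of Thomason height 1 is partitioned into the two non-empty sets $$\mathrm{Th}_1^+=\{H \mid Z\subseteq H\neq G\}\quad\text{and}\quad \mathrm{Th}_1^-=\{H\mid \tilde T\subseteq H\neq G\}.$$ -/

import Mathlib

open scoped TensorProduct Pointwise Topology

set_option linter.unusedSectionVars false

/-! ### The identity component and the component group -/

/-- The identity component `𝕋` of a topological group `G`. -/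
abbrev identityTorus (G : Type*) [Group G] [TopologicalSpace G] [IsTopologicalGroup G] :
    Subgroup G :=
  Subgroup.connectedComponentOfOne G

/-- `G` is an extension `1 → 𝕋 → G → W → 1` whose identity component `𝕋` is a 2-torus and whose
component group `W = G / 𝕋` has order 2. (Such a `G` is automatically a compact Lie group.) -/
class IsRankTwoToral (G : Type*) [Group G] [TopologicalSpace G] [IsTopologicalGroup G] : Prop where
  torus_equiv : Nonempty (identityTorus G ≃ₜ* Circle × Circle)
  index_eq_two : (identityTorus G).index = 2

instance identityTorus_normal (G : Type*) [Group G] [TopologicalSpace G] [IsTopologicalGroup G] :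
    (identityTorus G).Normal where
  conj_mem n hn g := by
    have hc : Continuous fun x : G => g * x * g⁻¹ := by fun_prop
    have h := hc.image_connectedComponent_subset (1 : G) ⟨n, hn, rfl⟩
    rw [mul_one, mul_inv_cancel] at h
    exact h

instance identityTorus_commGroup (G : Type*) [Group G] [TopologicalSpace G]
    [IsTopologicalGroup G] [hG : IsRankTwoToral G] : CommGroup (identityTorus G) where
  mul_comm a b := by
    obtain ⟨e⟩ := hG.torus_equiv
    apply e.injective
    rw [map_mul, map_mul, mul_comm]

section Torus

variable (G : Type*) [Group G] [TopologicalSpace G] [IsTopologicalGroup G]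

/-- The action of `g : G` on `𝕋` by conjugation. -/
def conjTorus {G : Type*} [Group G] [TopologicalSpace G] [IsTopologicalGroup G] (g : G) :
    identityTorus G →ₜ* identityTorus G where
  toMonoidHom := (MulAut.conjNormal (H := identityTorus G) g).toMonoidHom
  continuous_toFun := by
    refine Continuous.subtype_mk (f := fun x : identityTorus G => g * (x : G) * g⁻¹) ?_ _
    fun_prop

variable [IsRankTwoToral G]

/-- The toral lattice `Λ₀ = H₁(𝕋; ℤ)`, as the group of continuous homomorphisms from the circle
to the torus `𝕋`. -/
abbrev ToralLattice : Type _ := Additive (Circle →ₜ* identityTorus G)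

/-- The action of `g : G` on the toral lattice induced by conjugation (it depends only on the
image of `g` in `W`). -/
noncomputable def latticeAction {G : Type*} [Group G] [TopologicalSpace G] [IsTopologicalGroup G]
    [IsRankTwoToral G] (g : G) : ToralLattice G →ₗ[ℤ] ToralLattice G :=
  AddMonoidHom.toIntLinearMap
    { toFun := fun l => Additive.ofMul ((conjTorus g).comp l.toMul)
      map_zero' := by
        apply Additive.toMul.injective
        ext z
        exact congrArg Subtype.val (map_one (conjTorus g))
      map_add' := fun l l' => by
        apply Additive.toMul.injective
        ext z
        exact congrArg Subtype.val (map_mul (conjTorus g) (l.toMul z) (l'.toMul z)) }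

/-- `G` is of mixed type: the rational representation `H₁(𝕋; ℚ) = ℚ ⊗ Λ₀` of `W` is isomorphic to
the sum of the trivial representation `ℚ` and the sign representation. -/
def IsMixedType : Prop :=
  ∃ e : (ℚ ⊗[ℤ] ToralLattice G) ≃ₗ[ℚ] ℚ × ℚ,
    ∀ g : G, g ∉ identityTorus G → ∀ x : ℚ ⊗[ℤ] ToralLattice G,
      e ((latticeAction g).baseChange ℚ x) = ((e x).1, -(e x).2)

/-! ### The Lie algebra, and the circles given by the two eigenspaces -/

/-- The Lie algebra `L𝕋 = LG`, as the space of one-parameter subgroups of `𝕋`. -/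
def LieTorus : Type _ := ℝ →ₜ+ Additive (identityTorus G)

noncomputable instance : AddCommGroup (LieTorus G) :=
  inferInstanceAs (AddCommGroup (ℝ →ₜ+ Additive (identityTorus G)))

end Torus

section Lie

variable {G : Type*} [Group G] [TopologicalSpace G] [IsTopologicalGroup G] [IsRankTwoToral G]

namespace LieTorus

/-- The point `X(t) = exp (t X)` of the one-parameter subgroup `X`, as an element of `G`. -/
def eval (X : LieTorus G) (t : ℝ) : G :=
  ((ContinuousAddMonoidHom.toAddMonoidHom X t).toMul : identityTorus G)

@[ext]
theorem ext_eval {X Y : LieTorus G} (h : ∀ t, X.eval t = Y.eval t) : X = Y :=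
  ContinuousAddMonoidHom.ext (A := ℝ) (B := Additive (identityTorus G))
    fun t => Additive.toMul.injective (Subtype.ext (h t))

theorem eval_zero (t : ℝ) : (0 : LieTorus G).eval t = 1 := rfl

theorem eval_add (X Y : LieTorus G) (t : ℝ) : (X + Y).eval t = X.eval t * Y.eval t := rfl

theorem eval_neg (X : LieTorus G) (t : ℝ) : (-X).eval t = (X.eval t)⁻¹ := rfl

theorem eval_time_zero (X : LieTorus G) : X.eval 0 = 1 := by
  simp [eval]

theorem eval_time_add (X : LieTorus G) (s t : ℝ) : X.eval (s + t) = X.eval s * X.eval t := by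
  simp [eval]

/-- Scalar multiplication in the Lie algebra: `(r X)(t) = X(r t)`. -/
noncomputable instance : SMul ℝ (LieTorus G) where
  smul r X := ContinuousAddMonoidHom.comp (B := ℝ) (C := Additive (identityTorus G)) X
    { toAddMonoidHom := AddMonoidHom.mulLeft r
      continuous_toFun := continuous_const.mul continuous_id }

theorem eval_smul (r : ℝ) (X : LieTorus G) (t : ℝ) : (r • X).eval t = X.eval (r * t) := rfl

noncomputable instance : Module ℝ (LieTorus G) where
  one_smul X := by ext t; rw [eval_smul, one_mul]
  mul_smul r s X := by
    ext t; rw [eval_smul, eval_smul, eval_smul, mul_comm r s, mul_assoc]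
  smul_zero r := by ext t; rw [eval_smul, eval_zero, eval_zero]
  smul_add r X Y := by
    ext t; rw [eval_smul, eval_add, eval_add, eval_smul, eval_smul]
  add_smul r s X := by
    ext t; rw [eval_smul, eval_add, eval_smul, eval_smul, add_mul, eval_time_add]
  zero_smul X := by ext t; rw [eval_smul, zero_mul, eval_time_zero, eval_zero]

/-- The adjoint action of `g : G` on `L𝕋`: `(Ad g X)(t) = g X(t) g⁻¹`. -/
def adjoint (g : G) (X : LieTorus G) : LieTorus G :=
  ContinuousAddMonoidHom.comp (A := ℝ) (B := Additive (identityTorus G))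
    (C := Additive (identityTorus G))
    { toAddMonoidHom := MonoidHom.toAdditive (conjTorus g).toMonoidHom
      continuous_toFun := (conjTorus g).continuous_toFun } X

theorem eval_adjoint (g : G) (X : LieTorus G) (t : ℝ) :
    (adjoint g X).eval t = g * X.eval t * g⁻¹ := rfl

/-- The `+1` eigenspace of the action of `W` on `L𝕋`. -/
def plusSpace (G : Type*) [Group G] [TopologicalSpace G] [IsTopologicalGroup G]
    [IsRankTwoToral G] : Set (LieTorus G) :=
  {X | ∀ g : G, g ∉ identityTorus G → adjoint g X = X}

/-- The `-1` eigenspace of the action of (the non-trivial element of) `W` on `L𝕋`. -/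
def minusSpace (G : Type*) [Group G] [TopologicalSpace G] [IsTopologicalGroup G]
    [IsRankTwoToral G] : Set (LieTorus G) :=
  {X | ∀ g : G, g ∉ identityTorus G → adjoint g X = -X}

end LieTorus

/-- The subgroup `Z`: the image of the `+1` eigenspace of `L𝕋` under the exponential map. -/
def circleZ (G : Type*) [Group G] [TopologicalSpace G] [IsTopologicalGroup G]
    [IsRankTwoToral G] : Subgroup G where
  carrier := {x | ∃ X ∈ LieTorus.plusSpace G, X.eval 1 = x}
  one_mem' := ⟨0, fun g _ => by
    ext t; rw [LieTorus.eval_adjoint, LieTorus.eval_zero, mul_one, mul_inv_cancel], rfl⟩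
  mul_mem' := by
    rintro _ _ ⟨X, hX, rfl⟩ ⟨Y, hY, rfl⟩
    refine ⟨X + Y, fun g hg => ?_, rfl⟩
    ext t
    rw [LieTorus.eval_adjoint, LieTorus.eval_add, conj_mul.symm, ← LieTorus.eval_adjoint,
      ← LieTorus.eval_adjoint, hX g hg, hY g hg]
  inv_mem' := by
    rintro _ ⟨X, hX, rfl⟩
    refine ⟨-X, fun g hg => ?_, rfl⟩
    ext t
    rw [LieTorus.eval_adjoint, LieTorus.eval_neg, conj_inv.symm, ← LieTorus.eval_adjoint, hX g hg]

/-- The subgroup `T̃`: the image of the `-1` eigenspace of `L𝕋` under the exponential map. -/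
def circleTilde (G : Type*) [Group G] [TopologicalSpace G] [IsTopologicalGroup G]
    [IsRankTwoToral G] : Subgroup G where
  carrier := {x | ∃ X ∈ LieTorus.minusSpace G, X.eval 1 = x}
  one_mem' := ⟨0, fun g _ => by
    ext t; rw [LieTorus.eval_adjoint, neg_zero, LieTorus.eval_zero, mul_one, mul_inv_cancel], rfl⟩
  mul_mem' := by
    rintro _ _ ⟨X, hX, rfl⟩ ⟨Y, hY, rfl⟩
    refine ⟨X + Y, fun g hg => ?_, rfl⟩
    ext t
    rw [LieTorus.eval_adjoint, LieTorus.eval_add, conj_mul.symm, ← LieTorus.eval_adjoint,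
      ← LieTorus.eval_adjoint, hX g hg, hY g hg, ← LieTorus.eval_add, neg_add]
  inv_mem' := by
    rintro _ ⟨X, hX, rfl⟩
    refine ⟨-X, fun g hg => ?_, rfl⟩
    ext t
    rw [LieTorus.eval_adjoint, LieTorus.eval_neg, conj_inv.symm, ← LieTorus.eval_adjoint, hX g hg,
      LieTorus.eval_neg (-X)]

/-- The Lie algebra `LH = {X | exp (t X) ∈ H for all t}` of a closed subgroup `H` of `G`. Every
one-parameter subgroup of `G` lies in `𝕋`, so this is a subspace of `L𝕋`. -/
def lieSubspace (H : ClosedSubgroup G) : Submodule ℝ (LieTorus G) where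
  carrier := {X | ∀ t : ℝ, X.eval t ∈ H}
  zero_mem' t := by rw [LieTorus.eval_zero]; exact one_mem H
  add_mem' hX hY t := by rw [LieTorus.eval_add]; exact mul_mem (hX t) (hY t)
  smul_mem' r X hX t := by rw [LieTorus.eval_smul]; exact hX (r * t)

/-- The dimension of a closed subgroup `H` of `G`. -/
noncomputable def lieDim (H : ClosedSubgroup G) : ℕ :=
  Module.finrank ℝ (lieSubspace H)

end Lie

/-! ### Thomason height in a topological space -/

/-- A Thomason subset: a union of closed subsets with quasi-compact complement. -/
def IsThomason {X : Type*} [TopologicalSpace X] (A : Set X) : Prop :=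
  ∃ C : Set (Set X), (∀ c ∈ C, IsClosed c ∧ IsCompact cᶜ) ∧ A = ⋃₀ C

/-- What is left of `X` after `n` steps of the Thomason filtration: at each step one removes
from the remaining subspace those points which, as singletons, are Thomason subsets of it. -/
def thomasonRemainder (X : Type*) [TopologicalSpace X] : ℕ → Set X
  | 0 => Set.univ
  | n + 1 => {x | ∃ hx : x ∈ thomasonRemainder X n,
      ¬ IsThomason ({⟨x, hx⟩} : Set (thomasonRemainder X n))}

/-- The Thomason height of a point `x`: the `n` such that `x` is still present after `n` steps of
the Thomason filtration and is removed in the next one (`⊤` if there is no such `n`). -/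
noncomputable def thomasonHeight {X : Type*} [TopologicalSpace X] (x : X) : ℕ∞ :=
  ⨅ n : {n : ℕ // x ∉ thomasonRemainder X (n + 1)}, ((n : ℕ) : ℕ∞)

/-! ### The space of conjugacy classes of closed subgroups -/

section Classes

variable (G : Type*) [Group G] [TopologicalSpace G]

/-- Closed subgroups up to conjugacy. -/
def conjSetoid : Setoid (ClosedSubgroup G) where
  r H K := ∃ g : G, MulAut.conj g • (H : Subgroup G) = K
  iseqv :=
    { refl := fun H => ⟨1, by simp⟩
      symm := by
        rintro H K ⟨g, h⟩
        exact ⟨g⁻¹, by rw [← h, map_inv, inv_smul_smul]⟩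
      trans := by
        rintro H K L ⟨g, h⟩ ⟨g', h'⟩
        exact ⟨g' * g, by rw [map_mul, mul_smul, h, h']⟩ }

/-- The set `𝔛_G = Sub(G)/G` of conjugacy classes of closed subgroups of `G`. -/
def ConjClassSpace : Type _ := Quotient (conjSetoid G)

variable {G}

/-- The conjugacy class of a closed subgroup. -/
def ClosedSubgroup.conjClass (H : ClosedSubgroup G) : ConjClassSpace G :=
  Quotient.mk (conjSetoid G) H

/-- `K` is cotoral in `H`: `K` is a normal subgroup of `H`, and the quotient `H / K` is a torus
(of some dimension `d ≥ 0`). -/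
def IsCotoral (K H : ClosedSubgroup G) : Prop :=
  K ≤ H ∧ ∃ _ : ((K : Subgroup G).subgroupOf (H : Subgroup G)).Normal, ∃ d : ℕ,
    Nonempty ((↥(H : Subgroup G) ⧸ (K : Subgroup G).subgroupOf (H : Subgroup G)) ≃ₜ*
      (Fin d → Circle))

/-- A conjugacy class is cotoral in another one if this holds for some representatives. -/
def IsCotoralClass (x y : ConjClassSpace G) : Prop :=
  ∃ K H : ClosedSubgroup G, K.conjClass = x ∧ H.conjClass = y ∧ IsCotoral K H

end Classes

section Zariski

variable {G : Type*} [Group G] [MetricSpace G] [CompactSpace G]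

/-- A closed subgroup of a compact metric group, as a non-empty compact set. -/
def ClosedSubgroup.toNonemptyCompacts (H : ClosedSubgroup G) :
    TopologicalSpace.NonemptyCompacts G where
  carrier := (H : Set G)
  isCompact' := H.isClosed'.isCompact
  nonempty' := ⟨1, one_mem H⟩

variable (G)

/-- The topology on `Sub(G)` given by the Hausdorff metric. -/
@[reducible]
def hausdorffTopology : TopologicalSpace (ClosedSubgroup G) :=
  TopologicalSpace.induced ClosedSubgroup.toNonemptyCompacts inferInstance

/-- The h-topology on `𝔛_G = Sub(G)/G`: the quotient of the Hausdorff metric topology. -/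
@[reducible]
def hTopology : TopologicalSpace (ConjClassSpace G) :=
  TopologicalSpace.coinduced ClosedSubgroup.conjClass (hausdorffTopology G)

/-- The Zariski topology on `𝔛_G`: the closed sets are the h-closed sets which are closed under
passage to cotoral subgroups. -/
instance zariskiTopology : TopologicalSpace (ConjClassSpace G) :=
  TopologicalSpace.ofClosed
    {A | IsClosed[hTopology G] A ∧ ∀ x y, IsCotoralClass x y → y ∈ A → x ∈ A}
    ⟨@isClosed_empty _ (hTopology G), fun _ _ _ h => h⟩
    (fun _ hS => ⟨@isClosed_sInter _ (hTopology G) _ fun A hA => (hS hA).1,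
      fun x y hxy hy A hA => (hS hA).2 x y hxy (hy A hA)⟩)
    (fun _ hA _ hB => ⟨@IsClosed.union _ _ _ (hTopology G) hA.1 hB.1,
      fun x y hxy hy => hy.imp (hA.2 x y hxy) (hB.2 x y hxy)⟩)

end Zariski

/-! ### Full subgroups -/

section Full

variable {G : Type*} [Group G]

/-- A closed subgroup `H` is full if it maps onto the component group `W = G / 𝕋`. -/
def IsFull [TopologicalSpace G] [IsTopologicalGroup G] (H : ClosedSubgroup G) : Prop :=
  (H : Subgroup G).map (QuotientGroup.mk' (identityTorus G)) = ⊤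

/-- The set of full (closed) subgroups of `G`. -/
abbrev FullSubgroup (G : Type*) [Group G] [TopologicalSpace G] [IsTopologicalGroup G] : Type _ :=
  {H : ClosedSubgroup G // IsFull H}

/-- The space `𝒱 ⊆ 𝔛_G` of conjugacy classes of full subgroups (with the subspace topology of the
Zariski topology). -/
abbrev FullClass (G : Type*) [Group G] [TopologicalSpace G] [IsTopologicalGroup G] : Type _ :=
  {x : ConjClassSpace G // ∃ H : ClosedSubgroup G, IsFull H ∧ H.conjClass = x}

/-- The conjugacy class of a full subgroup, as a point of `𝒱`. -/
def FullSubgroup.conjClass [TopologicalSpace G] [IsTopologicalGroup G] (H : FullSubgroup G) :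
    FullClass G :=
  ⟨H.1.conjClass, H.1, H.2, rfl⟩

/-- The Thomason height of a full subgroup `H`: that of its conjugacy class in the space `𝒱` of
conjugacy classes of full subgroups. -/
noncomputable def FullSubgroup.height [MetricSpace G] [IsTopologicalGroup G] [CompactSpace G]
    (H : FullSubgroup G) : ℕ∞ :=
  thomasonHeight H.conjClass

/-- The set `↑K` of full subgroups containing `K`. -/
def upSet [TopologicalSpace G] [IsTopologicalGroup G] (K : Subgroup G) : Set (FullSubgroup G) :=
  {H | K ≤ (H.1 : Subgroup G)}

/-- The Weyl group `W_G(H) = N_G(H) / H`. -/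
abbrev WeylGroup (H : Subgroup G) : Type _ :=
  ↥(Subgroup.normalizer (H : Set G)) ⧸ H.subgroupOf (Subgroup.normalizer (H : Set G))

end Full

/-! ### The circle group -/

theorem Circle.exists_pow_eq {n : ℕ} (hn : n ≠ 0) (z : Circle) : ∃ w : Circle, w ^ n = z := by
  obtain ⟨x, rfl⟩ := Circle.exp_surjective z
  refine ⟨Circle.exp (x / n), ?_⟩
  rw [← Circle.exp_nsmul, nsmul_eq_mul]
  congr 1
  field_simp

theorem Circle.finite_pow_eq_one {n : ℕ} (hn : n ≠ 0) : {z : Circle | z ^ n = 1}.Finite := by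
  refine Set.Finite.of_finite_image (f := ((↑) : Circle → ℂ)) ?_ Circle.coe_injective.injOn
  refine (Polynomial.nthRoots n (1 : ℂ)).toFinset.finite_toSet.subset ?_
  rintro _ ⟨z, hz, rfl⟩
  rw [Finset.mem_coe, Multiset.mem_toFinset, Polynomial.mem_nthRoots (Nat.pos_of_ne_zero hn)]
  have := congrArg ((↑) : Circle → ℂ) (show z ^ n = 1 from hz)
  simpa using this

theorem Circle.eq_one_of_dist_pow_lt {z : Circle} (h : ∀ n : ℕ, ‖((z ^ n : Circle) : ℂ) - 1‖ < 1) :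
    z = 1 := by
  have key : ∀ w : ℂ, ‖w - 1‖ < 1 → ‖w‖ = 1 → (3 / 2 : ℝ) * ‖w - 1‖ ≤ ‖w ^ 2 - 1‖ := by
    intro w hw hw1
    have h2 : w ^ 2 - 1 = (w - 1) * (w + 1) := by ring
    rw [h2, norm_mul, mul_comm]
    refine mul_le_mul_of_nonneg_left ?_ (norm_nonneg _)
    have h3 : ‖w - 1‖ ^ 2 + ‖w + 1‖ ^ 2 = 4 := by
      have := parallelogram_law_with_norm ℝ w 1
      rw [hw1] at this
      norm_num at this
      nlinarith
    nlinarith [norm_nonneg (w + 1), norm_nonneg (w - 1),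
      norm_sub_norm_le (2 : ℂ) (1 - w), norm_sub_rev w 1,
      show (2 : ℂ) - (1 - w) = w + 1 by ring]
  have grow : ∀ n : ℕ, (3 / 2 : ℝ) ^ n * ‖(z : ℂ) - 1‖ ≤ ‖((z ^ 2 ^ n : Circle) : ℂ) - 1‖ := by
    intro n
    induction n with
    | zero => simp
    | succ n ih =>
      have := key ((z ^ 2 ^ n : Circle) : ℂ) (h _) (Circle.norm_coe _)
      rw [pow_succ 2 n, pow_mul z, Circle.coe_pow (z ^ 2 ^ n) 2]
      refine le_trans ?_ this
      rw [pow_succ]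
      nlinarith
  by_contra hz
  have hpos : 0 < ‖(z : ℂ) - 1‖ := by
    rw [norm_pos_iff, sub_ne_zero]
    exact fun h1 => hz (Circle.coe_injective (by simpa using h1))
  obtain ⟨n, hn⟩ := pow_unbounded_of_one_lt (1 / ‖(z : ℂ) - 1‖) (by norm_num : (1 : ℝ) < 3 / 2)
  have h1 := (div_lt_iff₀ hpos).1 hn
  linarith [grow n, h (2 ^ n)]

theorem Circle.exists_nhds_no_subgroup :
    ∃ U ∈ 𝓝 (1 : Circle), ∀ z : Circle, (∀ n : ℕ, z ^ n ∈ U) → z = 1 := by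
  refine ⟨{z | ‖(z : ℂ) - 1‖ < 1}, ?_, fun z hz => Circle.eq_one_of_dist_pow_lt hz⟩
  refine IsOpen.mem_nhds (isOpen_lt (by fun_prop) continuous_const) ?_
  simp

theorem Circle.dense_torsion : Dense {z : Circle | ∃ n : ℕ, n ≠ 0 ∧ z ^ n = 1} := by
  have hd : DenseRange fun q : ℚ => Circle.exp (2 * Real.pi * (q : ℝ)) := by
    have hs : Function.Surjective fun x : ℝ => Circle.exp (2 * Real.pi * x) := by
      intro z
      obtain ⟨x, rfl⟩ := Circle.exp_surjective z
      refine ⟨x / (2 * Real.pi), ?_⟩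
      have := Real.pi_ne_zero
      dsimp only
      congr 1
      field_simp
    exact hs.denseRange.comp Rat.denseRange_cast (by fun_prop)
  refine hd.mono ?_
  rintro _ ⟨q, rfl⟩
  refine ⟨q.den, q.den_nz, ?_⟩
  rw [← Circle.exp_nsmul, Circle.exp_eq_one]
  refine ⟨q.num, ?_⟩
  have : (q.den : ℝ) * (q : ℝ) = q.num := by exact_mod_cast Rat.den_mul_eq_num q
  rw [nsmul_eq_mul, ← this]
  ring

theorem Circle.closed_subgroup_eq_top {A : Subgroup Circle} (hA : IsClosed (A : Set Circle))
    (hinf : ¬ (A : Set Circle).Finite) : A = ⊤ := by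
  let B : AddSubgroup ℝ :=
    { carrier := {x | Circle.exp x ∈ A}
      zero_mem' := by simp [one_mem]
      add_mem' := fun {x y} hx hy => by
        simpa only [Set.mem_ofPred_eq, Circle.exp_add] using mul_mem hx hy
      neg_mem' := fun {x} hx => by
        simpa only [Set.mem_ofPred_eq, Circle.exp_neg] using inv_mem hx }
  have hB : IsClosed (B : Set ℝ) := hA.preimage Circle.exp.continuous
  have hmem : ∀ x, x ∈ B ↔ Circle.exp x ∈ A := fun _ => Iff.rfl
  rcases B.dense_or_cyclic with hd | ⟨a, ha⟩
  · rw [eq_top_iff]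
    intro z _
    obtain ⟨x, rfl⟩ := Circle.exp_surjective z
    rw [← hmem, ← SetLike.mem_coe, ← hB.closure_eq]
    exact hd x
  · exfalso
    apply hinf
    have h2 : 2 * Real.pi ∈ B := by rw [hmem, Circle.exp_two_pi]; exact one_mem _
    rw [ha, AddSubgroup.mem_closure_singleton] at h2
    obtain ⟨n, hn⟩ := h2
    have hn0 : n ≠ 0 := by
      rintro rfl
      have := Real.pi_pos
      rw [zero_smul] at hn
      linarith
    refine (Circle.finite_pow_eq_one (Int.natAbs_ne_zero.2 hn0)).subset fun z hz => ?_
    obtain ⟨x, rfl⟩ := Circle.exp_surjective z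
    have hx : x ∈ B := hz
    rw [ha, AddSubgroup.mem_closure_singleton] at hx
    obtain ⟨m, rfl⟩ := hx
    have h1 : Circle.exp (m • a) ^ n = 1 := by
      rw [← Circle.exp_zsmul, smul_comm, hn, Circle.exp_eq_one]
      exact ⟨m, by rw [zsmul_eq_mul]⟩
    rcases Int.natAbs_eq n with h | h
    · rw [h, zpow_natCast] at h1; exact h1
    · rw [h, zpow_neg, zpow_natCast, inv_eq_one] at h1; exact h1

theorem Circle.exists_exp_of_continuous_hom (f : ℝ → Circle) (hf : Continuous f)
    (hadd : ∀ s t, f (s + t) = f s * f t) : ∃ a : ℝ, ∀ t, f t = Circle.exp (a * t) := by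
  have h0 : f 0 = 1 := by simpa using hadd 0 0
  obtain ⟨F, ⟨hF0, hF⟩, -⟩ := Circle.isCoveringMap_exp.existsUnique_continuousMap_lifts
    ⟨f, hf⟩ 0 0 (by simp [h0])
  have hF' : ∀ t, Circle.exp (F t) = f t := fun t => congrFun hF t
  have hadd' : ∀ s t, F (s + t) = F s + F t := by
    have hconst : ∀ p : ℝ × ℝ, F (p.1 + p.2) - F p.1 - F p.2 = 0 := by
      have hc : Continuous fun p : ℝ × ℝ => F (p.1 + p.2) - F p.1 - F p.2 := by fun_prop
      have h1 : ∀ p : ℝ × ℝ, Circle.exp (F (p.1 + p.2) - F p.1 - F p.2) = 1 := by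
        intro p
        rw [Circle.exp_sub, Circle.exp_sub, hF', hF', hF', hadd]
        simp
      intro p
      have := Circle.isCoveringMap_exp.const_of_comp hc (fun a a' => by
        rw [h1, h1]) p (0, 0)
      rw [this]
      simp [hF0]
    intro s t
    have := hconst (s, t)
    simp only at this
    linarith
  let g : ℝ →+ ℝ := ⟨⟨F, hF0⟩, hadd'⟩
  refine ⟨F 1, fun t => ?_⟩
  have h2 : F (t • (1 : ℝ)) = t • F 1 := map_real_smul g F.continuous t 1
  rw [smul_eq_mul, mul_one, smul_eq_mul] at h2
  rw [← hF', h2, mul_comm]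

/-! ### The torus and its involution -/

section TorusFacts

variable {G : Type*} [Group G] [TopologicalSpace G] [IsTopologicalGroup G] [hG : IsRankTwoToral G]

theorem identityTorus_exists_pow_eq {n : ℕ} (hn : n ≠ 0) (t : identityTorus G) :
    ∃ s : identityTorus G, s ^ n = t := by
  obtain ⟨e⟩ := hG.torus_equiv
  obtain ⟨a, ha⟩ := Circle.exists_pow_eq hn (e t).1
  obtain ⟨b, hb⟩ := Circle.exists_pow_eq hn (e t).2
  refine ⟨e.symm (a, b), e.injective ?_⟩
  rw [map_pow, e.apply_symm_apply, Prod.pow_mk, ha, hb]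

theorem identityTorus_finite_pow_eq_one {n : ℕ} (hn : n ≠ 0) :
    {t : identityTorus G | t ^ n = 1}.Finite := by
  obtain ⟨e⟩ := hG.torus_equiv
  refine Set.Finite.of_finite_image (f := e) ?_ e.injective.injOn
  refine ((Circle.finite_pow_eq_one hn).prod (Circle.finite_pow_eq_one hn)).subset ?_
  rintro _ ⟨t, ht, rfl⟩
  have h : e t ^ n = 1 := by rw [← map_pow, show t ^ n = 1 from ht, map_one]
  exact ⟨congrArg Prod.fst h, congrArg Prod.snd h⟩

theorem identityTorus_no_small_subgroups :
    ∃ U ∈ 𝓝 (1 : identityTorus G), ∀ t : identityTorus G, (∀ n : ℕ, t ^ n ∈ U) → t = 1 := by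
  obtain ⟨e⟩ := hG.torus_equiv
  obtain ⟨U, hU, h⟩ := Circle.exists_nhds_no_subgroup
  refine ⟨e ⁻¹' (U ×ˢ U), ?_, fun t ht => ?_⟩
  · refine (map_continuous e).continuousAt.preimage_mem_nhds ?_
    rw [map_one]
    exact prod_mem_nhds hU hU
  · apply e.injective
    rw [map_one]
    refine Prod.ext (h _ fun n => ?_) (h _ fun n => ?_)
    · have := (ht n).1
      rwa [map_pow] at this
    · have := (ht n).2
      rwa [map_pow] at this

theorem identityTorus_dense_torsion :
    Dense {t : identityTorus G | ∃ n : ℕ, n ≠ 0 ∧ t ^ n = 1} := by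
  obtain ⟨e⟩ := hG.torus_equiv
  have h := (Circle.dense_torsion.prod Circle.dense_torsion).preimage e.toHomeomorph.isOpenMap
  refine h.mono ?_
  rintro t ⟨⟨n, hn, h1⟩, ⟨m, hm, h2⟩⟩
  refine ⟨n * m, mul_ne_zero hn hm, e.injective ?_⟩
  rw [map_pow, map_one]
  have h1' : (e t).1 ^ n = 1 := h1
  have h2' : (e t).2 ^ m = 1 := h2
  refine Prod.ext ?_ ?_
  · rw [Prod.pow_fst, pow_mul, h1', one_pow]; rfl
  · rw [Prod.pow_snd, mul_comm, pow_mul, h2', one_pow]; rfl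

instance identityTorus_compactSpace : CompactSpace (identityTorus G) := by
  obtain ⟨e⟩ := hG.torus_equiv
  exact e.symm.toHomeomorph.compactSpace

instance identityTorus_t2Space : T2Space (identityTorus G) := by
  obtain ⟨e⟩ := hG.torus_equiv
  exact e.symm.toHomeomorph.t2Space

theorem mul_mem_identityTorus_of_notMem {g h : G} (hg : g ∉ identityTorus G)
    (hh : h ∉ identityTorus G) : g * h ∈ identityTorus G :=
  (Subgroup.mul_mem_iff_of_index_two hG.index_eq_two).2 (by tauto)

theorem identityTorus_isClosed : IsClosed (identityTorus G : Set G) :=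
  isClosed_connectedComponent

theorem identityTorus_isOpen : IsOpen (identityTorus G : Set G) := by
  have : (identityTorus G).FiniteIndex := ⟨by rw [hG.index_eq_two]; norm_num⟩
  exact Subgroup.isOpen_of_isClosed_of_finiteIndex _ identityTorus_isClosed

theorem coe_conjTorus (g : G) (t : identityTorus G) :
    ((conjTorus g t : identityTorus G) : G) = g * t * g⁻¹ := rfl

theorem conjTorus_of_mem {g : G} (hg : g ∈ identityTorus G) (t : identityTorus G) :
    conjTorus g t = t := by
  have := mul_comm (⟨g, hg⟩ : identityTorus G) t
  apply Subtype.ext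
  rw [coe_conjTorus, mul_inv_eq_iff_eq_mul]
  exact congrArg Subtype.val this

theorem conjTorus_mul (g h : G) (t : identityTorus G) :
    conjTorus (g * h) t = conjTorus g (conjTorus h t) := by
  apply Subtype.ext
  simp only [coe_conjTorus]
  group

variable (G) in
theorem exists_notMem_identityTorus : ∃ g : G, g ∉ identityTorus G := by
  by_contra! h
  have h1 : identityTorus G = ⊤ := (Subgroup.eq_top_iff' _).2 h
  have h2 := hG.index_eq_two
  rw [h1, Subgroup.index_top] at h2
  norm_num at h2

variable (G) in
/-- The action on `𝕋` of the non-trivial element of `W`. -/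
noncomputable def torusInvolution : identityTorus G →ₜ* identityTorus G :=
  conjTorus (exists_notMem_identityTorus G).choose

theorem conjTorus_eq_torusInvolution {g : G} (hg : g ∉ identityTorus G) (t : identityTorus G) :
    conjTorus g t = torusInvolution G t := by
  have hc := (exists_notMem_identityTorus G).choose_spec
  set c := (exists_notMem_identityTorus G).choose with hcdef
  have h1 : g * c⁻¹ ∈ identityTorus G :=
    mul_mem_identityTorus_of_notMem hg (fun h => hc (by simpa using inv_mem h))
  have h2 := conjTorus_mul (g * c⁻¹) c t
  rw [inv_mul_cancel_right, conjTorus_of_mem h1] at h2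
  exact h2

theorem conj_eq_torusInvolution {g : G} (hg : g ∉ identityTorus G) (t : identityTorus G) :
    g * t * g⁻¹ = (torusInvolution G t : identityTorus G) := by
  rw [← conjTorus_eq_torusInvolution hg, coe_conjTorus]

theorem mul_coe_eq_torusInvolution_mul {g : G} (hg : g ∉ identityTorus G) (t : identityTorus G) :
    g * t = (torusInvolution G t : identityTorus G) * g := by
  rw [← conj_eq_torusInvolution hg, inv_mul_cancel_right]

@[simp]
theorem torusInvolution_torusInvolution (t : identityTorus G) :
    torusInvolution G (torusInvolution G t) = t := by
  obtain ⟨g, hg⟩ := exists_notMem_identityTorus G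
  rw [← conjTorus_eq_torusInvolution hg, ← conjTorus_eq_torusInvolution hg, ← conjTorus_mul,
    conjTorus_of_mem (mul_mem_identityTorus_of_notMem hg hg)]

variable (G) in
/-- The homomorphism `t ↦ t σ(t)`. -/
noncomputable def symmHom : identityTorus G →ₜ* identityTorus G :=
  ContinuousMonoidHom.id _ * torusInvolution G

variable (G) in
/-- The homomorphism `t ↦ t / σ(t)`. -/
noncomputable def skewHom : identityTorus G →ₜ* identityTorus G :=
  ContinuousMonoidHom.id _ * (torusInvolution G)⁻¹

theorem symmHom_apply (t : identityTorus G) : symmHom G t = t * torusInvolution G t := rfl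

theorem skewHom_apply (t : identityTorus G) : skewHom G t = t * (torusInvolution G t)⁻¹ := rfl

@[simp]
theorem torusInvolution_symmHom (t : identityTorus G) :
    torusInvolution G (symmHom G t) = symmHom G t := by
  rw [symmHom_apply, map_mul, torusInvolution_torusInvolution, mul_comm]

@[simp]
theorem torusInvolution_skewHom (t : identityTorus G) :
    torusInvolution G (skewHom G t) = (skewHom G t)⁻¹ := by
  rw [skewHom_apply, map_mul, map_inv, torusInvolution_torusInvolution, mul_inv, inv_inv, mul_comm]

theorem symmHom_mul_skewHom (t : identityTorus G) : symmHom G t * skewHom G t = t ^ 2 := by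
  rw [symmHom_apply, skewHom_apply, mul_mul_mul_comm, mul_inv_cancel, mul_one, sq]

theorem symmHom_skewHom (t : identityTorus G) : symmHom G (skewHom G t) = 1 := by
  rw [symmHom_apply, torusInvolution_skewHom, mul_inv_cancel]

theorem skewHom_symmHom (t : identityTorus G) : skewHom G (symmHom G t) = 1 := by
  rw [skewHom_apply, torusInvolution_symmHom, mul_inv_cancel]

/-- A subgroup `C` of `𝕋` which is the image of an equivariant endomorphism `ψ` of `𝕋`, together
with an endomorphism whose kernel is, up to `2`-torsion, equal to `C`. -/
structure IsTorusCore (C : Subgroup (identityTorus G)) : Prop where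
  exists_range : ∃ ψ : identityTorus G →ₜ* identityTorus G, ψ.toMonoidHom.range = C
  involution_mem : ∀ t ∈ C, torusInvolution G t ∈ C
  exists_ker : ∃ φ : identityTorus G →ₜ* identityTorus G,
    (∀ t ∈ C, φ t = 1) ∧ ∀ t, φ t = 1 → t ^ 2 ∈ C

variable (G) in
/-- The image of `t ↦ t σ(t)`. -/
noncomputable def symmTorus : Subgroup (identityTorus G) := (symmHom G).toMonoidHom.range

variable (G) in
/-- The image of `t ↦ t / σ(t)`. -/
noncomputable def skewTorus : Subgroup (identityTorus G) := (skewHom G).toMonoidHom.range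

theorem symmHom_mem (t : identityTorus G) : symmHom G t ∈ symmTorus G := ⟨t, rfl⟩

theorem skewHom_mem (t : identityTorus G) : skewHom G t ∈ skewTorus G := ⟨t, rfl⟩

theorem torusInvolution_of_mem_symmTorus {t : identityTorus G} (ht : t ∈ symmTorus G) :
    torusInvolution G t = t := by
  obtain ⟨s, rfl⟩ := ht
  exact torusInvolution_symmHom s

theorem torusInvolution_of_mem_skewTorus {t : identityTorus G} (ht : t ∈ skewTorus G) :
    torusInvolution G t = t⁻¹ := by
  obtain ⟨s, rfl⟩ := ht
  exact torusInvolution_skewHom s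

theorem isTorusCore_bot : IsTorusCore (⊥ : Subgroup (identityTorus G)) where
  exists_range := ⟨1, by ext; simp [eq_comm]⟩
  involution_mem t ht := by rw [Subgroup.mem_bot] at ht ⊢; rw [ht, map_one]
  exists_ker := ⟨ContinuousMonoidHom.id _, fun t ht => ht, fun t ht => by
    have : t = 1 := ht
    rw [this, one_pow]; exact one_mem _⟩

theorem isTorusCore_top : IsTorusCore (⊤ : Subgroup (identityTorus G)) where
  exists_range := ⟨ContinuousMonoidHom.id _, by ext x; simp⟩
  involution_mem _ _ := Subgroup.mem_top _
  exists_ker := ⟨1, fun _ _ => rfl, fun _ _ => Subgroup.mem_top _⟩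

theorem isTorusCore_symmTorus : IsTorusCore (symmTorus G) where
  exists_range := ⟨symmHom G, rfl⟩
  involution_mem t ht := by rwa [torusInvolution_of_mem_symmTorus ht]
  exists_ker := ⟨skewHom G, by rintro _ ⟨t, rfl⟩; exact skewHom_symmHom t, fun t ht => by
    rw [← symmHom_mul_skewHom, ht, mul_one]; exact symmHom_mem t⟩

theorem isTorusCore_skewTorus : IsTorusCore (skewTorus G) where
  exists_range := ⟨skewHom G, rfl⟩
  involution_mem t ht := by rw [torusInvolution_of_mem_skewTorus ht]; exact inv_mem ht
  exists_ker := ⟨symmHom G, by rintro _ ⟨t, rfl⟩; exact symmHom_skewHom t, fun t ht => by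
    rw [← symmHom_mul_skewHom, ht, one_mul]; exact skewHom_mem t⟩

theorem eq_top_of_symmTorus_le_of_skewTorus_le {S : Subgroup (identityTorus G)}
    (h1 : symmTorus G ≤ S) (h2 : skewTorus G ≤ S) : S = ⊤ := by
  rw [Subgroup.eq_top_iff']
  intro t
  obtain ⟨s, rfl⟩ := identityTorus_exists_pow_eq two_ne_zero t
  rw [← symmHom_mul_skewHom]
  exact mul_mem (h1 (symmHom_mem s)) (h2 (skewHom_mem s))

namespace IsTorusCore

variable {C : Subgroup (identityTorus G)} (hC : IsTorusCore C)
include hC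

theorem exists_pow_eq {n : ℕ} (hn : n ≠ 0) {c : identityTorus G} (hc : c ∈ C) :
    ∃ d ∈ C, d ^ n = c := by
  obtain ⟨ψ, rfl⟩ := hC.exists_range
  obtain ⟨t, rfl⟩ := hc
  obtain ⟨s, rfl⟩ := identityTorus_exists_pow_eq hn t
  exact ⟨ψ s, ⟨s, rfl⟩, (map_pow ψ s n).symm⟩

theorem isClosed : IsClosed (C : Set (identityTorus G)) := by
  obtain ⟨ψ, rfl⟩ := hC.exists_range
  exact (isCompact_range ψ.continuous_toFun).isClosed

theorem subset_closure_torsion :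
    (C : Set (identityTorus G)) ⊆ closure {t | t ∈ C ∧ ∃ n : ℕ, n ≠ 0 ∧ t ^ n = 1} := by
  obtain ⟨ψ, rfl⟩ := hC.exists_range
  rintro _ ⟨t, rfl⟩
  refine map_mem_closure ψ.continuous_toFun (identityTorus_dense_torsion t) ?_
  rintro s ⟨n, hn, hs⟩
  exact ⟨⟨s, rfl⟩, n, hn, by
    change ψ s ^ n = 1
    rw [← map_pow, hs, map_one]⟩

/-- An element whose `n`-th power lies in `C` is the product of an element of `C` and an `n`-torsion
element. -/
theorem exists_mul_torsion {n : ℕ} (hn : n ≠ 0) {t : identityTorus G} (ht : t ^ n ∈ C) :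
    ∃ c ∈ C, ∃ r : identityTorus G, r ^ n = 1 ∧ t = c * r := by
  obtain ⟨c, hc, h⟩ := hC.exists_pow_eq hn ht
  exact ⟨c, hc, c⁻¹ * t, by rw [mul_pow, inv_pow, h, inv_mul_cancel], by rw [mul_inv_cancel_left]⟩

theorem le_of_pow_mem {S : Subgroup (identityTorus G)} {n : ℕ} (hn : n ≠ 0)
    (h : ∀ c ∈ C, c ^ n ∈ S) : C ≤ S := by
  intro c hc
  obtain ⟨d, hd, rfl⟩ := hC.exists_pow_eq hn hc
  exact h d hd

end IsTorusCore

end TorusFacts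

/-! ### The Lie algebra of the torus -/

section LieFacts

variable {G : Type*} [Group G] [TopologicalSpace G] [IsTopologicalGroup G] [hG : IsRankTwoToral G]

namespace LieTorus

/-- The point `exp (t X)` as an element of `𝕋`. -/
def curve (X : LieTorus G) (t : ℝ) : identityTorus G :=
  (ContinuousAddMonoidHom.toAddMonoidHom X t).toMul

theorem ext_curve {X Y : LieTorus G} (h : ∀ t, X.curve t = Y.curve t) : X = Y :=
  ext_eval fun t => congrArg Subtype.val (h t)

theorem curve_zero (t : ℝ) : (0 : LieTorus G).curve t = 1 := rfl

theorem curve_add (X Y : LieTorus G) (t : ℝ) : (X + Y).curve t = X.curve t * Y.curve t := rfl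

theorem curve_neg (X : LieTorus G) (t : ℝ) : (-X).curve t = (X.curve t)⁻¹ := rfl

theorem curve_smul (r : ℝ) (X : LieTorus G) (t : ℝ) : (r • X).curve t = X.curve (r * t) := rfl

theorem curve_nsmul (n : ℕ) (X : LieTorus G) (t : ℝ) : (n • X).curve t = X.curve t ^ n := by
  induction n with
  | zero => rw [zero_smul, curve_zero, pow_zero]
  | succ n ih => rw [succ_nsmul, curve_add, ih, pow_succ]

/-- The one-parameter subgroup given by an additive continuous curve in `𝕋`. -/
def ofCurve (f : ℝ → identityTorus G) (hf : Continuous f) (hadd : ∀ s t, f (s + t) = f s * f t) :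
    LieTorus G :=
  ContinuousAddMonoidHom.mk (A := ℝ) (B := Additive (identityTorus G))
    (AddMonoidHom.mk' (fun t => Additive.ofMul (f t)) hadd) hf

theorem curve_ofCurve (f : ℝ → identityTorus G) (hf : Continuous f)
    (hadd : ∀ s t, f (s + t) = f s * f t) (t : ℝ) : (ofCurve f hf hadd).curve t = f t := rfl

theorem continuous_curve (X : LieTorus G) : Continuous X.curve :=
  ContinuousAddMonoidHom.continuous_toFun (A := ℝ) (B := Additive (identityTorus G)) X

theorem curve_time_add (X : LieTorus G) (s t : ℝ) : X.curve (s + t) = X.curve s * X.curve t :=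
  Subtype.ext (eval_time_add X s t)

theorem mem_plusSpace {X : LieTorus G} :
    X ∈ plusSpace G ↔ ∀ t, torusInvolution G (X.curve t) = X.curve t := by
  constructor
  · intro h t
    obtain ⟨g, hg⟩ := exists_notMem_identityTorus G
    have := congrArg (fun Y : LieTorus G => Y.curve t) (h g hg)
    rw [← conjTorus_eq_torusInvolution hg]
    exact this
  · intro h g hg
    refine ext_curve fun t => ?_
    rw [← h t, ← conjTorus_eq_torusInvolution hg]
    rfl

theorem mem_minusSpace {X : LieTorus G} :
    X ∈ minusSpace G ↔ ∀ t, torusInvolution G (X.curve t) = (X.curve t)⁻¹ := by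
  constructor
  · intro h t
    obtain ⟨g, hg⟩ := exists_notMem_identityTorus G
    have := congrArg (fun Y : LieTorus G => Y.curve t) (h g hg)
    rw [← conjTorus_eq_torusInvolution hg]
    exact this
  · intro h g hg
    refine ext_curve fun t => ?_
    rw [curve_neg, ← h t, ← conjTorus_eq_torusInvolution hg]
    rfl

/-- The coordinates on the Lie algebra given by an isomorphism of `𝕋` with a product of circles. -/
noncomputable def ofCoords (e : identityTorus G ≃ₜ* Circle × Circle) :
    (ℝ × ℝ) →ₗ[ℝ] LieTorus G where
  toFun p := ofCurve (fun t => e.symm (Circle.exp (p.1 * t), Circle.exp (p.2 * t)))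
    ((map_continuous e.symm).comp (by fun_prop)) (fun s t => by
      rw [← map_mul]; simp [mul_add, Circle.exp_add])
  map_add' p q := ext_curve fun t => by
    rw [curve_add, curve_ofCurve, curve_ofCurve, curve_ofCurve, ← map_mul]
    simp [add_mul, Circle.exp_add]
  map_smul' r p := ext_curve fun t => by
    rw [RingHom.id_apply, curve_smul, curve_ofCurve, curve_ofCurve]
    simp only [Prod.smul_fst, Prod.smul_snd, smul_eq_mul]
    rw [show r * p.1 * t = p.1 * (r * t) by ring, show r * p.2 * t = p.2 * (r * t) by ring]

theorem curve_ofCoords (e : identityTorus G ≃ₜ* Circle × Circle) (p : ℝ × ℝ) (t : ℝ) :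
    (ofCoords e p).curve t = e.symm (Circle.exp (p.1 * t), Circle.exp (p.2 * t)) := rfl

theorem ofCoords_bijective (e : identityTorus G ≃ₜ* Circle × Circle) :
    Function.Bijective (ofCoords e) := by
  have key : ∀ a : ℝ, (∀ t, Circle.exp (a * t) = 1) → a = 0 := by
    intro a h
    by_contra ha
    have := h (Real.pi / a)
    rw [mul_div_cancel₀ _ ha] at this
    exact Circle.exp_pi_ne_one this
  constructor
  · rw [← LinearMap.ker_eq_bot, LinearMap.ker_eq_bot']
    intro p hp
    have h : ∀ t, (Circle.exp (p.1 * t), Circle.exp (p.2 * t)) = (1 : Circle × Circle) := by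
      intro t
      apply e.symm.injective
      rw [← curve_ofCoords, hp, map_one, curve_zero]
    exact Prod.ext (key _ fun t => congrArg Prod.fst (h t)) (key _ fun t => congrArg Prod.snd (h t))
  · intro X
    have hc : Continuous fun t => e (X.curve t) := (map_continuous e).comp X.continuous_curve
    obtain ⟨a, ha⟩ := Circle.exists_exp_of_continuous_hom (fun t => (e (X.curve t)).1)
      hc.fst (fun s t => by rw [curve_time_add, map_mul]; rfl)
    obtain ⟨b, hb⟩ := Circle.exists_exp_of_continuous_hom (fun t => (e (X.curve t)).2)
      hc.snd (fun s t => by rw [curve_time_add, map_mul]; rfl)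
    refine ⟨(a, b), ext_curve fun t => ?_⟩
    rw [curve_ofCoords, ← ha, ← hb]
    exact e.symm_apply_apply _

variable (G) in
theorem finrank_eq_two : Module.finrank ℝ (LieTorus G) = 2 := by
  obtain ⟨e⟩ := hG.torus_equiv
  rw [← (LinearEquiv.ofBijective _ (ofCoords_bijective e)).finrank_eq]
  simp

instance finiteDimensional : FiniteDimensional ℝ (LieTorus G) :=
  FiniteDimensional.of_finrank_pos (by rw [finrank_eq_two]; norm_num)

theorem exists_curve_one_eq (t : identityTorus G) : ∃ X : LieTorus G, X.curve 1 = t := by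
  obtain ⟨e⟩ := hG.torus_equiv
  obtain ⟨a, ha⟩ := Circle.exp_surjective (e t).1
  obtain ⟨b, hb⟩ := Circle.exp_surjective (e t).2
  refine ⟨ofCoords e (a, b), ?_⟩
  rw [curve_ofCoords]
  simp only [mul_one, ha, hb]
  exact e.symm_apply_apply _

/-- The one-parameter subgroup defined by an element of the toral lattice. -/
noncomputable def ofLattice (l : Circle →ₜ* identityTorus G) : LieTorus G :=
  ofCurve (fun t => l (Circle.exp t)) ((map_continuous l).comp Circle.exp.continuous)
    fun s t => by rw [Circle.exp_add, map_mul]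

theorem curve_ofLattice (l : Circle →ₜ* identityTorus G) (t : ℝ) :
    (ofLattice l).curve t = l (Circle.exp t) := rfl

theorem ofLattice_ne_zero {l : Circle →ₜ* identityTorus G} {z : Circle} (hz : l z ≠ 1) :
    ofLattice l ≠ 0 := by
  obtain ⟨x, rfl⟩ := Circle.exp_surjective z
  intro h
  apply hz
  rw [← curve_ofLattice, h, curve_zero]

end LieTorus

theorem circleZ_eq_map : circleZ G = (symmTorus G).map (identityTorus G).subtype := by
  ext x
  constructor
  · rintro ⟨X, hX, rfl⟩
    rw [LieTorus.mem_plusSpace] at hX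
    refine ⟨X.curve 1, ?_, rfl⟩
    have : symmHom G (X.curve (1 / 2)) = X.curve 1 := by
      rw [symmHom_apply, hX, ← LieTorus.curve_time_add]
      norm_num
    rw [← this]
    exact symmHom_mem _
  · rintro ⟨_, ⟨t, rfl⟩, rfl⟩
    obtain ⟨X, rfl⟩ := LieTorus.exists_curve_one_eq t
    let Y : LieTorus G := LieTorus.ofCurve (fun t => symmHom G (X.curve t))
      ((map_continuous (symmHom G)).comp X.continuous_curve)
      fun s t => by rw [X.curve_time_add, map_mul]
    exact ⟨Y, LieTorus.mem_plusSpace.2 fun t => torusInvolution_symmHom _, rfl⟩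

theorem circleTilde_eq_map : circleTilde G = (skewTorus G).map (identityTorus G).subtype := by
  ext x
  constructor
  · rintro ⟨X, hX, rfl⟩
    rw [LieTorus.mem_minusSpace] at hX
    refine ⟨X.curve 1, ?_, rfl⟩
    have : skewHom G (X.curve (1 / 2)) = X.curve 1 := by
      rw [skewHom_apply, hX, inv_inv, ← LieTorus.curve_time_add]
      norm_num
    rw [← this]
    exact skewHom_mem _
  · rintro ⟨_, ⟨t, rfl⟩, rfl⟩
    obtain ⟨X, rfl⟩ := LieTorus.exists_curve_one_eq t
    let Y : LieTorus G := LieTorus.ofCurve (fun t => skewHom G (X.curve t))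
      ((map_continuous (skewHom G)).comp X.continuous_curve)
      fun s t => by rw [X.curve_time_add, map_mul]
    exact ⟨Y, LieTorus.mem_minusSpace.2 fun t => torusInvolution_skewHom _, rfl⟩

theorem latticeAction_apply {g : G} (hg : g ∉ identityTorus G) (l : ToralLattice G) (z : Circle) :
    (latticeAction g l).toMul z = torusInvolution G (l.toMul z) :=
  conjTorus_eq_torusInvolution hg _

theorem IsMixedType.exists_symm (h : IsMixedType G) :
    ∃ l : Circle →ₜ* identityTorus G, (∀ z, torusInvolution G (l z) = l z) ∧ ∃ z, l z ≠ 1 := by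
  obtain ⟨e, he⟩ := h
  obtain ⟨g, hg⟩ := exists_notMem_identityTorus G
  by_contra! hcon
  have h1 : latticeAction g = -(LinearMap.id : ToralLattice G →ₗ[ℤ] ToralLattice G) := by
    refine LinearMap.ext fun l => Additive.toMul.injective (ContinuousMonoidHom.ext fun z => ?_)
    rw [latticeAction_apply hg]
    have := hcon ((symmHom G).comp l.toMul) (fun z => torusInvolution_symmHom _) z
    exact eq_inv_of_mul_eq_one_right this
  have h2 := he g hg (e.symm (1, 0))
  rw [h1, LinearMap.baseChange_neg, LinearMap.baseChange_id] at h2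
  simp at h2
  norm_num at h2

theorem IsMixedType.exists_skew (h : IsMixedType G) :
    ∃ l : Circle →ₜ* identityTorus G, (∀ z, torusInvolution G (l z) = (l z)⁻¹) ∧ ∃ z, l z ≠ 1 := by
  obtain ⟨e, he⟩ := h
  obtain ⟨g, hg⟩ := exists_notMem_identityTorus G
  by_contra! hcon
  have h1 : latticeAction g = (LinearMap.id : ToralLattice G →ₗ[ℤ] ToralLattice G) := by
    refine LinearMap.ext fun l => Additive.toMul.injective (ContinuousMonoidHom.ext fun z => ?_)
    rw [latticeAction_apply hg]
    have := hcon ((skewHom G).comp l.toMul) (fun z => torusInvolution_skewHom _) z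
    exact (mul_inv_eq_one.1 this).symm
  have h2 := he g hg (e.symm (0, 1))
  rw [h1, LinearMap.baseChange_id] at h2
  simp at h2
  norm_num at h2

/-- Generators of the two eigenspaces of the involution on the Lie algebra, which come from the
toral lattice. -/
theorem IsMixedType.exists_lattice_basis (h : IsMixedType G) :
    ∃ l m : Circle →ₜ* identityTorus G,
      (∀ z, torusInvolution G (l z) = l z) ∧ (∀ z, torusInvolution G (m z) = (m z)⁻¹) ∧
      LieTorus.ofLattice l ≠ 0 ∧ LieTorus.ofLattice m ≠ 0 ∧
      ∀ X : LieTorus G, ∃ a b : ℝ, X = a • LieTorus.ofLattice l + b • LieTorus.ofLattice m := by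
  obtain ⟨l, hl, z, hz⟩ := h.exists_symm
  obtain ⟨m, hm, w, hw⟩ := h.exists_skew
  have hl0 := LieTorus.ofLattice_ne_zero hz
  have hm0 := LieTorus.ofLattice_ne_zero hw
  refine ⟨l, m, hl, hm, hl0, hm0, ?_⟩
  have hli : LinearIndependent ℝ ![LieTorus.ofLattice l, LieTorus.ofLattice m] := by
    rw [LinearIndependent.pair_iff]
    intro a b hab
    have h1 : ∀ t, l (Circle.exp (a * t)) * m (Circle.exp (b * t)) = 1 := by
      intro t
      have := congrArg (fun Y : LieTorus G => Y.curve t) hab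
      exact this
    have h2 : ∀ t, l (Circle.exp (a * t)) * (m (Circle.exp (b * t)))⁻¹ = 1 := by
      intro t
      have := congrArg (torusInvolution G) (h1 t)
      rwa [map_mul, hl, hm, map_one] at this
    have h3 : (2 * a) • LieTorus.ofLattice l = 0 := by
      refine LieTorus.ext_curve fun t => ?_
      rw [LieTorus.curve_smul, LieTorus.curve_ofLattice, LieTorus.curve_zero, mul_assoc, two_mul,
        Circle.exp_add, map_mul]
      have := congrArg₂ (· * ·) (h1 t) (h2 t)
      simpa [mul_mul_mul_comm] using this
    have ha : a = 0 := by
      rcases smul_eq_zero.1 h3 with h4 | h4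
      · linarith
      · exact absurd h4 hl0
    rw [ha, zero_smul, zero_add] at hab
    exact ⟨ha, (smul_eq_zero.1 hab).resolve_right hm0⟩
  have hspan := hli.span_eq_top_of_card_eq_finrank' (by simp [LieTorus.finrank_eq_two])
  intro X
  have hX : X ∈ Submodule.span ℝ (Set.range ![LieTorus.ofLattice l, LieTorus.ofLattice m]) := by
    rw [hspan]; trivial
  rw [Matrix.range_cons_cons_empty, Submodule.mem_span_pair] at hX
  obtain ⟨a, b, hab⟩ := hX
  exact ⟨a, b, hab.symm⟩

end LieFacts

/-! ### Full subgroups and their dimension -/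

section FullFacts

variable {G : Type*} [Group G] [TopologicalSpace G] [IsTopologicalGroup G] [hG : IsRankTwoToral G]

theorem isFull_iff {H : ClosedSubgroup G} : IsFull H ↔ ∃ h ∈ H, h ∉ identityTorus G := by
  obtain ⟨c, hc⟩ := exists_notMem_identityTorus G
  constructor
  · intro h
    have : (QuotientGroup.mk' (identityTorus G)) c ∈
        (H : Subgroup G).map (QuotientGroup.mk' (identityTorus G)) := by
      rw [show (H : Subgroup G).map _ = ⊤ from h]; trivial
    obtain ⟨k, hk, hkc⟩ := this
    refine ⟨k, hk, fun hkT => hc ?_⟩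
    have h1 := (QuotientGroup.eq (s := identityTorus G)).1 hkc
    simpa using mul_mem hkT h1
  · rintro ⟨k, hk, hkT⟩
    refine (Subgroup.eq_top_iff' _).2 fun x => ?_
    obtain ⟨g, rfl⟩ := QuotientGroup.mk'_surjective _ x
    by_cases hg : g ∈ identityTorus G
    · refine ⟨1, one_mem H, ?_⟩
      rw [map_one]
      exact ((QuotientGroup.eq_one_iff g).2 hg).symm
    · refine ⟨k, hk, (QuotientGroup.eq (s := identityTorus G)).2 ?_⟩
      exact mul_mem_identityTorus_of_notMem (fun h => hkT (by simpa using inv_mem h)) hg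

/-- The intersection of a closed subgroup with `𝕋`, as a subgroup of `𝕋`. -/
def torusPart (H : ClosedSubgroup G) : Subgroup (identityTorus G) :=
  (H : Subgroup G).subgroupOf (identityTorus G)

theorem mem_torusPart {H : ClosedSubgroup G} {t : identityTorus G} :
    t ∈ torusPart H ↔ (t : G) ∈ H := Iff.rfl

theorem isClosed_torusPart (H : ClosedSubgroup G) :
    IsClosed (torusPart H : Set (identityTorus G)) :=
  H.isClosed'.preimage continuous_subtype_val

theorem IsFull.torusInvolution_mem {H : ClosedSubgroup G} (hH : IsFull H) {t : identityTorus G}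
    (ht : t ∈ torusPart H) : torusInvolution G t ∈ torusPart H := by
  obtain ⟨h, hh, hT⟩ := isFull_iff.1 hH
  rw [mem_torusPart, ← conj_eq_torusInvolution hT]
  exact mul_mem (mul_mem hh ht) (inv_mem hh)

theorem IsFull.symmHom_mem {H : ClosedSubgroup G} (hH : IsFull H) {t : identityTorus G}
    (ht : t ∈ torusPart H) : symmHom G t ∈ torusPart H :=
  mul_mem ht (hH.torusInvolution_mem ht)

theorem IsFull.skewHom_mem {H : ClosedSubgroup G} (hH : IsFull H) {t : identityTorus G}
    (ht : t ∈ torusPart H) : skewHom G t ∈ torusPart H :=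
  mul_mem ht (inv_mem (hH.torusInvolution_mem ht))

/-- Conjugate full subgroups have the same intersection with `𝕋`. -/
theorem IsFull.torusPart_conj {H K : ClosedSubgroup G} (hH : IsFull H) {g : G}
    (hg : MulAut.conj g • (H : Subgroup G) = K) : torusPart K = torusPart H := by
  ext t
  rw [mem_torusPart, ← SetLike.mem_coe, show ((K : Set G)) = ((K : Subgroup G) : Set G) from rfl,
    ← hg, SetLike.mem_coe, Subgroup.mem_pointwise_smul_iff_inv_smul_mem]
  have h1 : ((MulAut.conj g)⁻¹ • (t : G)) = (conjTorus g⁻¹ t : identityTorus G) := by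
    rw [← map_inv]; rfl
  rw [h1]
  by_cases hgT : g⁻¹ ∈ identityTorus G
  · rw [conjTorus_of_mem hgT]; rfl
  · rw [conjTorus_eq_torusInvolution hgT]
    constructor
    · intro h
      have := hH.torusInvolution_mem (t := torusInvolution G t) h
      rwa [torusInvolution_torusInvolution] at this
    · exact fun h => hH.torusInvolution_mem h

theorem IsFull.eq_top {H : ClosedSubgroup G} (hH : IsFull H) (h : torusPart H = ⊤) :
    (H : Subgroup G) = ⊤ := by
  obtain ⟨c, hc, hT⟩ := isFull_iff.1 hH
  have h1 : ∀ t : identityTorus G, (t : G) ∈ H := fun t => by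
    rw [← mem_torusPart, h]; trivial
  refine (Subgroup.eq_top_iff' _).2 fun g => ?_
  by_cases hg : g ∈ identityTorus G
  · exact h1 ⟨g, hg⟩
  · have h2 := mul_mem_identityTorus_of_notMem hg (fun h => hT (by simpa using inv_mem h) :
      c⁻¹ ∉ identityTorus G)
    have := mul_mem (h1 ⟨_, h2⟩) hc
    rwa [inv_mul_cancel_right] at this

/-- `C` is contained in `S`, and `S / C` is of finite exponent. -/
def HasCore (S C : Subgroup (identityTorus G)) : Prop :=
  C ≤ S ∧ ∃ k : ℕ, k ≠ 0 ∧ ∀ s ∈ S, s ^ k ∈ C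

theorem mem_lieSubspace {H : ClosedSubgroup G} {X : LieTorus G} :
    X ∈ lieSubspace H ↔ ∀ t, X.curve t ∈ torusPart H := Iff.rfl

theorem lieDim_congr {H K : ClosedSubgroup G} (h : torusPart H = torusPart K) :
    lieDim H = lieDim K := by
  have : lieSubspace H = lieSubspace K := by
    ext X
    rw [mem_lieSubspace, mem_lieSubspace, h]
  rw [lieDim, lieDim, this]

theorem nsmul_eq_zero_lieTorus {k : ℕ} (hk : k ≠ 0) {X : LieTorus G} (h : k • X = 0) : X = 0 := by
  rw [← Nat.cast_smul_eq_nsmul ℝ] at h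
  exact (smul_eq_zero.1 h).resolve_left (Nat.cast_ne_zero.2 hk)

theorem lieDim_of_hasCore_bot {H : ClosedSubgroup G} (h : HasCore (torusPart H) ⊥) :
    lieDim H = 0 := by
  obtain ⟨-, k, hk, hS⟩ := h
  have : lieSubspace H = ⊥ := by
    refine (Submodule.eq_bot_iff _).2 fun X hX => nsmul_eq_zero_lieTorus hk ?_
    refine LieTorus.ext_curve fun t => ?_
    rw [LieTorus.curve_nsmul]
    exact hS _ (mem_lieSubspace.1 hX t)
  rw [lieDim, this, finrank_bot]

theorem lieDim_of_hasCore_top {H : ClosedSubgroup G} (h : HasCore (torusPart H) ⊤) :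
    lieDim H = 2 := by
  have : lieSubspace H = ⊤ :=
    (Submodule.eq_top_iff'.2 fun X => mem_lieSubspace.2 fun t => h.1 trivial)
  rw [lieDim, this, finrank_top, LieTorus.finrank_eq_two]

theorem lieDim_of_hasCore_symmTorus (hM : IsMixedType G) {H : ClosedSubgroup G}
    (h : HasCore (torusPart H) (symmTorus G)) : lieDim H = 1 := by
  obtain ⟨l, m, hl, hm, hl0, hm0, hX⟩ := hM.exists_lattice_basis
  obtain ⟨hle, k, hk, hS⟩ := h
  have : lieSubspace H = Submodule.span ℝ {LieTorus.ofLattice l} := by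
    refine le_antisymm (fun X hXH => ?_) ?_
    · obtain ⟨a, b, rfl⟩ := hX X
      have hb : (2 * k * b : ℝ) • LieTorus.ofLattice m = 0 := by
        refine LieTorus.ext_curve fun t => ?_
        have h1 := hS _ (mem_lieSubspace.1 hXH t)
        have h2 := torusInvolution_of_mem_symmTorus h1
        rw [LieTorus.curve_add, LieTorus.curve_smul, LieTorus.curve_smul, LieTorus.curve_ofLattice,
          LieTorus.curve_ofLattice, map_pow, map_mul, hl, hm, mul_pow, mul_pow,
          mul_right_inj, inv_pow, inv_eq_iff_mul_eq_one, ← pow_add] at h2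
        rw [LieTorus.curve_smul, LieTorus.curve_ofLattice, LieTorus.curve_zero,
          show 2 * k * b * t = (k + k : ℕ) * (b * t) by push_cast; ring, Circle.exp_natCast_mul,
          map_pow, h2]
      have hb0 : b = 0 := by
        have := (smul_eq_zero.1 hb).resolve_right hm0
        simpa [hk] using this
      rw [hb0, zero_smul, add_zero]
      exact Submodule.smul_mem _ _ (Submodule.mem_span_singleton_self _)
    · rw [Submodule.span_singleton_le_iff_mem, mem_lieSubspace]
      intro t
      obtain ⟨z, hz⟩ := Circle.exists_pow_eq two_ne_zero (Circle.exp t)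
      apply hle
      rw [LieTorus.curve_ofLattice, ← hz, map_pow, sq]
      nth_rewrite 2 [← hl z]
      exact symmHom_mem _
  rw [lieDim, this, finrank_span_singleton hl0]

theorem lieDim_of_hasCore_skewTorus (hM : IsMixedType G) {H : ClosedSubgroup G}
    (h : HasCore (torusPart H) (skewTorus G)) : lieDim H = 1 := by
  obtain ⟨l, m, hl, hm, hl0, hm0, hX⟩ := hM.exists_lattice_basis
  obtain ⟨hle, k, hk, hS⟩ := h
  have : lieSubspace H = Submodule.span ℝ {LieTorus.ofLattice m} := by
    refine le_antisymm (fun X hXH => ?_) ?_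
    · obtain ⟨a, b, rfl⟩ := hX X
      have ha : (2 * k * a : ℝ) • LieTorus.ofLattice l = 0 := by
        refine LieTorus.ext_curve fun t => ?_
        have h1 := hS _ (mem_lieSubspace.1 hXH t)
        have h2 := torusInvolution_of_mem_skewTorus h1
        rw [LieTorus.curve_add, LieTorus.curve_smul, LieTorus.curve_smul, LieTorus.curve_ofLattice,
          LieTorus.curve_ofLattice, map_pow, map_mul, hl, hm, mul_pow, mul_pow, mul_inv,
          inv_pow, mul_left_inj, eq_inv_iff_mul_eq_one, ← pow_add] at h2
        rw [LieTorus.curve_smul, LieTorus.curve_ofLattice, LieTorus.curve_zero,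
          show 2 * k * a * t = (k + k : ℕ) * (a * t) by push_cast; ring, Circle.exp_natCast_mul,
          map_pow, h2]
      have ha0 : a = 0 := by
        have := (smul_eq_zero.1 ha).resolve_right hl0
        simpa [hk] using this
      rw [ha0, zero_smul, zero_add]
      exact Submodule.smul_mem _ _ (Submodule.mem_span_singleton_self _)
    · rw [Submodule.span_singleton_le_iff_mem, mem_lieSubspace]
      intro t
      obtain ⟨z, hz⟩ := Circle.exists_pow_eq two_ne_zero (Circle.exp t)
      apply hle
      rw [LieTorus.curve_ofLattice, ← hz, map_pow, sq]
      have := skewHom_mem (m z)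
      rwa [skewHom_apply, hm, inv_inv] at this
  rw [lieDim, this, finrank_span_singleton hm0]

/-- A closed subgroup of `𝕋` meeting the image of a circle in an infinite set contains it. -/
theorem range_le_of_infinite_inter (l : Circle →ₜ* identityTorus G)
    {A : Subgroup (identityTorus G)} (hA : IsClosed (A : Set (identityTorus G)))
    (h : ¬ ((A ⊓ l.toMonoidHom.range : Subgroup (identityTorus G)) :
      Set (identityTorus G)).Finite) : l.toMonoidHom.range ≤ A := by
  have h1 : A.comap l.toMonoidHom = ⊤ := by
    refine Circle.closed_subgroup_eq_top (hA.preimage l.continuous_toFun) fun hfin => h ?_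
    refine (hfin.image l).subset ?_
    rintro _ ⟨hx, z, rfl⟩
    exact ⟨z, hx, rfl⟩
  rintro _ ⟨z, rfl⟩
  have : z ∈ A.comap l.toMonoidHom := by rw [h1]; trivial
  exact this

theorem IsMixedType.exists_symmTorus_eq_range (hM : IsMixedType G) :
    ∃ l : Circle →ₜ* identityTorus G, symmTorus G = l.toMonoidHom.range := by
  obtain ⟨l, m, hl, hm, hl0, hm0, hX⟩ := hM.exists_lattice_basis
  refine ⟨l, le_antisymm ?_ ?_⟩
  · rintro _ ⟨t, rfl⟩
    obtain ⟨X, rfl⟩ := LieTorus.exists_curve_one_eq t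
    obtain ⟨a, b, rfl⟩ := hX X
    refine ⟨Circle.exp (a * 1) ^ 2, ?_⟩
    change l (Circle.exp (a * 1) ^ 2) = symmHom G _
    rw [LieTorus.curve_add, LieTorus.curve_smul, LieTorus.curve_smul, LieTorus.curve_ofLattice,
      LieTorus.curve_ofLattice]
    generalize Circle.exp (a * 1) = z, Circle.exp (b * 1) = w
    rw [symmHom_apply, map_mul, hl, hm, mul_mul_mul_comm, mul_inv_cancel,
      mul_one, map_pow, sq]
  · rintro _ ⟨z, rfl⟩
    obtain ⟨w, rfl⟩ := Circle.exists_pow_eq two_ne_zero z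
    refine ⟨l w, ?_⟩
    change symmHom G (l w) = l (w ^ 2)
    rw [symmHom_apply, hl, map_pow, sq]

theorem IsMixedType.exists_skewTorus_eq_range (hM : IsMixedType G) :
    ∃ l : Circle →ₜ* identityTorus G, skewTorus G = l.toMonoidHom.range := by
  obtain ⟨l, m, hl, hm, hl0, hm0, hX⟩ := hM.exists_lattice_basis
  refine ⟨m, le_antisymm ?_ ?_⟩
  · rintro _ ⟨t, rfl⟩
    obtain ⟨X, rfl⟩ := LieTorus.exists_curve_one_eq t
    obtain ⟨a, b, rfl⟩ := hX X
    refine ⟨Circle.exp (b * 1) ^ 2, ?_⟩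
    change m (Circle.exp (b * 1) ^ 2) = skewHom G _
    rw [LieTorus.curve_add, LieTorus.curve_smul, LieTorus.curve_smul, LieTorus.curve_ofLattice,
      LieTorus.curve_ofLattice]
    generalize Circle.exp (a * 1) = z, Circle.exp (b * 1) = w
    rw [skewHom_apply, map_mul, hl, hm, mul_inv, inv_inv, mul_mul_mul_comm,
      mul_inv_cancel, one_mul, map_pow, sq]
  · rintro _ ⟨z, rfl⟩
    obtain ⟨w, rfl⟩ := Circle.exists_pow_eq two_ne_zero z
    refine ⟨m w, ?_⟩
    change skewHom G (m w) = m (w ^ 2)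
    rw [skewHom_apply, hm, inv_inv, map_pow, sq]

theorem exists_exponent_of_finite {A : Subgroup (identityTorus G)}
    (h : (A : Set (identityTorus G)).Finite) : ∃ k : ℕ, k ≠ 0 ∧ ∀ a ∈ A, a ^ k = 1 := by
  have : Finite A := h.to_subtype
  refine ⟨Nat.card A, Nat.card_pos.ne', fun a ha => ?_⟩
  have := pow_card_eq_one' (x := (⟨a, ha⟩ : A))
  exact congrArg Subtype.val this

/-- The intersection of a full subgroup with `𝕋` is finite, or contains exactly one of the two
circles, or is everything. -/
theorem IsFull.hasCore_cases (hM : IsMixedType G) {H : ClosedSubgroup G} (hH : IsFull H) :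
    HasCore (torusPart H) ⊥ ∨ HasCore (torusPart H) (symmTorus G) ∨
      HasCore (torusPart H) (skewTorus G) ∨ HasCore (torusPart H) ⊤ := by
  obtain ⟨l, hl⟩ := hM.exists_symmTorus_eq_range
  obtain ⟨m, hm⟩ := hM.exists_skewTorus_eq_range
  have hcl := isClosed_torusPart H
  by_cases h1 : ((torusPart H ⊓ symmTorus G : Subgroup (identityTorus G)) :
      Set (identityTorus G)).Finite <;>
    by_cases h2 : ((torusPart H ⊓ skewTorus G : Subgroup (identityTorus G)) :
      Set (identityTorus G)).Finite
  · left
    obtain ⟨a, ha0, ha⟩ := exists_exponent_of_finite h1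
    obtain ⟨b, hb0, hb⟩ := exists_exponent_of_finite h2
    refine ⟨bot_le, 2 * (a * b), mul_ne_zero two_ne_zero (mul_ne_zero ha0 hb0), fun s hs => ?_⟩
    rw [Subgroup.mem_bot, pow_mul, ← symmHom_mul_skewHom, mul_pow, pow_mul,
      ha _ ⟨hH.symmHom_mem hs, _root_.symmHom_mem s⟩, mul_comm a b, pow_mul (skewHom G s),
      hb _ ⟨hH.skewHom_mem hs, _root_.skewHom_mem s⟩, one_pow, one_pow, one_mul]
  · right; right; left
    obtain ⟨a, ha0, ha⟩ := exists_exponent_of_finite h1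
    refine ⟨?_, 2 * a, mul_ne_zero two_ne_zero ha0, fun s hs => ?_⟩
    · rw [hm] at h2 ⊢
      exact range_le_of_infinite_inter m hcl h2
    · rw [pow_mul, ← symmHom_mul_skewHom, mul_pow,
        ha _ ⟨hH.symmHom_mem hs, _root_.symmHom_mem s⟩, one_mul]
      exact pow_mem (_root_.skewHom_mem s) _
  · right; left
    obtain ⟨b, hb0, hb⟩ := exists_exponent_of_finite h2
    refine ⟨?_, 2 * b, mul_ne_zero two_ne_zero hb0, fun s hs => ?_⟩
    · rw [hl] at h1 ⊢
      exact range_le_of_infinite_inter l hcl h1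
    · rw [pow_mul, ← symmHom_mul_skewHom, mul_pow,
        hb _ ⟨hH.skewHom_mem hs, _root_.skewHom_mem s⟩, mul_one]
      exact pow_mem (_root_.symmHom_mem s) _
  · right; right; right
    have : torusPart H = ⊤ := by
      refine eq_top_of_symmTorus_le_of_skewTorus_le ?_ ?_
      · rw [hl] at h1 ⊢
        exact range_le_of_infinite_inter l hcl h1
      · rw [hm] at h2 ⊢
        exact range_le_of_infinite_inter m hcl h2
    rw [this]
    exact ⟨le_rfl, 1, one_ne_zero, fun _ _ => trivial⟩

end FullFacts

/-! ### The Hausdorff metric topology on the set of closed subgroups -/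

section Hausdorff

variable {G : Type*} [Group G] [MetricSpace G] [CompactSpace G]

attribute [local instance] hausdorffTopology

open TopologicalSpace Filter Topology

namespace ClosedSubgroup

theorem toNonemptyCompacts_injective :
    Function.Injective (toNonemptyCompacts : ClosedSubgroup G → NonemptyCompacts G) :=
  fun _ _ h => SetLike.coe_injective (congrArg (fun K : NonemptyCompacts G => (K : Set G)) h)

theorem isEmbedding_toNonemptyCompacts :
    IsEmbedding (toNonemptyCompacts : ClosedSubgroup G → NonemptyCompacts G) :=
  ⟨⟨rfl⟩, toNonemptyCompacts_injective⟩

theorem isOpen_setOf_subset {U : Set G} (hU : IsOpen U) :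
    IsOpen {K : ClosedSubgroup G | (K : Set G) ⊆ U} :=
  (NonemptyCompacts.isOpen_subsets_of_isOpen hU).preimage isEmbedding_toNonemptyCompacts.continuous

theorem isClosed_setOf_subset {F : Set G} (hF : IsClosed F) :
    IsClosed {K : ClosedSubgroup G | (K : Set G) ⊆ F} :=
  (NonemptyCompacts.isClosed_subsets_of_isClosed hF).preimage
    isEmbedding_toNonemptyCompacts.continuous

theorem isClosed_setOf_inter_nonempty {F : Set G} (hF : IsClosed F) :
    IsClosed {K : ClosedSubgroup G | ((K : Set G) ∩ F).Nonempty} :=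
  (NonemptyCompacts.isClosed_inter_nonempty_of_isClosed hF).preimage
    isEmbedding_toNonemptyCompacts.continuous

theorem isClosed_setOf_superset (A : Set G) :
    IsClosed {K : ClosedSubgroup G | A ⊆ K} := by
  have : {K : ClosedSubgroup G | A ⊆ K} =
      ⋂ a ∈ A, {K : ClosedSubgroup G | ((K : Set G) ∩ {a}).Nonempty} := by
    ext K
    simp [Set.subset_def]
  rw [this]
  exact isClosed_biInter fun a _ => isClosed_setOf_inter_nonempty isClosed_singleton

instance t2Space : T2Space (ClosedSubgroup G) := isEmbedding_toNonemptyCompacts.t2Space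

theorem tendsto_of_dense {u : ℕ → ClosedSubgroup G} {H : ClosedSubgroup G} (hle : ∀ n, u n ≤ H)
    (h : ∀ U : Set G, IsOpen U → ((H : Set G) ∩ U).Nonempty →
      ∀ᶠ n in atTop, ((u n : Set G) ∩ U).Nonempty) : Tendsto u atTop (𝓝 H) := by
  let := TopologicalSpace.vietoris G
  have he := NonemptyCompacts.isEmbedding_coe.comp (isEmbedding_toNonemptyCompacts (G := G))
  refine he.tendsto_nhds_iff.2 (tendsto_nhds_generateFrom_iff.2 ?_)
  rintro _ (⟨U, hU, rfl⟩ | ⟨U, hU, rfl⟩) hs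
  · exact Eventually.of_forall fun n x hx => hs (hle n hx)
  · exact h U hU hs

variable [IsTopologicalGroup G]

theorem isClosed_range_toNonemptyCompacts :
    IsClosed (Set.range (toNonemptyCompacts : ClosedSubgroup G → NonemptyCompacts G)) := by
  have h1 : IsClosed {K : NonemptyCompacts G | ((K : Set G) ∩ {1}).Nonempty} :=
    NonemptyCompacts.isClosed_inter_nonempty_of_isClosed isClosed_singleton
  have h2 : IsClosed {K : NonemptyCompacts G | ∀ x ∈ K, ∀ y ∈ K, x * y⁻¹ ∈ K} := by
    rw [← isOpen_compl_iff, isOpen_iff_mem_nhds]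
    intro K hK
    simp only [Set.mem_compl_iff, Set.mem_ofPred_eq, not_forall] at hK
    obtain ⟨x, hx, y, hy, hxy⟩ := hK
    obtain ⟨U, V, hU, hV, hxU, hKV, hUV⟩ := SeparatedNhds.of_isCompact_isCompact
      (isCompact_singleton (x := x * y⁻¹)) K.isCompact (Set.disjoint_singleton_left.2 hxy)
    have hc : Continuous fun p : G × G => p.1 * p.2⁻¹ := by fun_prop
    obtain ⟨A, B, hA, hB, hxA, hyB, hAB⟩ := isOpen_prod_iff.1 (hU.preimage hc) x y
      (hxU rfl)
    filter_upwards [(NonemptyCompacts.isOpen_subsets_of_isOpen hV).mem_nhds hKV,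
      (NonemptyCompacts.isOpen_inter_nonempty_of_isOpen hA).mem_nhds ⟨x, hx, hxA⟩,
      (NonemptyCompacts.isOpen_inter_nonempty_of_isOpen hB).mem_nhds ⟨y, hy, hyB⟩]
    rintro L hL ⟨a, ha, haA⟩ ⟨b, hb, hbB⟩ hcon
    exact Set.disjoint_left.1 hUV (hAB (Set.mk_mem_prod haA hbB)) (hL (hcon a ha b hb))
  convert h1.inter h2
  ext K
  constructor
  · rintro ⟨H, rfl⟩
    exact ⟨⟨1, one_mem H, rfl⟩, fun x hx y hy => mul_mem (s := H) hx
      (inv_mem (s := H) hy)⟩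
  · rintro ⟨⟨_, h1, rfl⟩, h2⟩
    have hinv : ∀ x ∈ K, x⁻¹ ∈ K := fun x hx => by simpa using h2 1 h1 x hx
    refine ⟨⟨{ carrier := K, one_mem' := h1, inv_mem' := fun {x} hx => hinv x hx,
               mul_mem' := fun {x y} hx hy => by simpa using h2 x hx _ (hinv y hy) },
      K.isCompact.isClosed⟩, ?_⟩
    exact SetLike.coe_injective rfl

instance compactSpace : CompactSpace (ClosedSubgroup G) :=
  IsClosedEmbedding.compactSpace
    ⟨isEmbedding_toNonemptyCompacts, isClosed_range_toNonemptyCompacts⟩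

/-- The conjugate `g H g⁻¹` of a closed subgroup. -/
def conjBy (g : G) (H : ClosedSubgroup G) : ClosedSubgroup G where
  toSubgroup := MulAut.conj g • (H : Subgroup G)
  isClosed' := by
    have h := (H.isClosed'.isCompact.image (f := fun x : G => g * x * g⁻¹) (by fun_prop)).isClosed
    exact h

theorem continuous_conjBy :
    Continuous fun p : G × ClosedSubgroup G => conjBy p.1 p.2 := by
  rw [isEmbedding_toNonemptyCompacts.continuous_iff]
  have h : Continuous fun p : G × ClosedSubgroup G =>
      (toNonemptyCompacts p.2).map (fun x => p.1 * x * p.1⁻¹) (by fun_prop) :=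
    Continuous.nonemptyCompacts_map' (f := fun p : G × ClosedSubgroup G => toNonemptyCompacts p.2)
      (g := fun (p : G × ClosedSubgroup G) x => p.1 * x * p.1⁻¹)
      (isEmbedding_toNonemptyCompacts.continuous.comp continuous_snd) (by
        simp only [Function.uncurry_def]; fun_prop)
  exact h

end ClosedSubgroup

open ClosedSubgroup

variable [IsTopologicalGroup G]

theorem conjClass_eq_iff {H K : ClosedSubgroup G} :
    H.conjClass = K.conjClass ↔ ∃ g, K = conjBy g H := by
  refine (Quotient.eq (r := conjSetoid G)).trans ?_
  exact exists_congr fun g => ⟨fun h => toSubgroup_injective h.symm, fun h => by rw [h]; rfl⟩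

@[simp]
theorem conjClass_conjBy (g : G) (H : ClosedSubgroup G) :
    (conjBy g H).conjClass = H.conjClass := (conjClass_eq_iff.2 ⟨g, rfl⟩).symm

theorem isClosed_hTopology_iff {B : Set (ConjClassSpace G)} :
    IsClosed[hTopology G] B ↔ IsClosed (ClosedSubgroup.conjClass ⁻¹' B) :=
  isClosed_coinduced

theorem isClosed_hTopology_image {A : Set (ClosedSubgroup G)} (hA : IsClosed A) :
    IsClosed[hTopology G] (ClosedSubgroup.conjClass '' A) := by
  rw [isClosed_hTopology_iff]
  have : ClosedSubgroup.conjClass ⁻¹' (ClosedSubgroup.conjClass '' A) =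
      (fun p : G × ClosedSubgroup G => conjBy p.1 p.2) '' (Set.univ ×ˢ A) := by
    ext K
    constructor
    · rintro ⟨H, hH, h⟩
      obtain ⟨g, rfl⟩ := conjClass_eq_iff.1 h
      exact ⟨(g, H), ⟨trivial, hH⟩, rfl⟩
    · rintro ⟨⟨g, H⟩, ⟨-, hH⟩, rfl⟩
      exact ⟨H, hH, (conjClass_conjBy g H).symm⟩
  rw [this]
  exact ((isCompact_univ.prod hA.isCompact).image continuous_conjBy).isClosed

theorem isClosed_setOf_conjClass_eq (x : ConjClassSpace G) :
    IsClosed {K : ClosedSubgroup G | K.conjClass = x} := by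
  obtain ⟨H, rfl⟩ := Quotient.exists_rep x
  have := isClosed_hTopology_iff.1 (isClosed_hTopology_image (isClosed_singleton (x := H)))
  rw [Set.image_singleton] at this
  exact this

theorem isClosed_zariski_iff {B : Set (ConjClassSpace G)} :
    IsClosed B ↔ IsClosed (ClosedSubgroup.conjClass ⁻¹' B) ∧
      ∀ x y, IsCotoralClass x y → y ∈ B → x ∈ B := by
  rw [← isClosed_hTopology_iff, ← isOpen_compl_iff]
  change Bᶜᶜ ∈ _ ↔ _
  rw [compl_compl]
  rfl

theorem continuous_conjClass :
    Continuous (ClosedSubgroup.conjClass : ClosedSubgroup G → ConjClassSpace G) :=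
  continuous_iff_isClosed.2 fun _ hB => (isClosed_zariski_iff.1 hB).1

end Hausdorff

/-! ### Isolated conjugacy classes -/

section Isolated

variable {G : Type*} [Group G] [MetricSpace G] [CompactSpace G] [IsTopologicalGroup G]
  [hG : IsRankTwoToral G]

attribute [local instance] hausdorffTopology

open ClosedSubgroup

theorem IsFull.conjBy {H : ClosedSubgroup G} (hH : IsFull H) (g : G) : IsFull (conjBy g H) := by
  obtain ⟨h, hh, hT⟩ := isFull_iff.1 hH
  refine isFull_iff.2 ⟨g * h * g⁻¹, ⟨h, hh, rfl⟩, fun hcon => hT ?_⟩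
  have := (identityTorus_normal G).conj_mem _ hcon g⁻¹
  simpa [mul_assoc] using this

theorem IsFull.torusPart_conjBy {H : ClosedSubgroup G} (hH : IsFull H) (g : G) :
    torusPart (ClosedSubgroup.conjBy g H) = torusPart H := hH.torusPart_conj rfl

theorem IsFull.of_conjClass_eq {H K : ClosedSubgroup G} (hH : IsFull H)
    (h : H.conjClass = K.conjClass) : IsFull K := by
  obtain ⟨g, rfl⟩ := conjClass_eq_iff.1 h
  exact hH.conjBy g

theorem IsFull.torusPart_eq_of_conjClass_eq {H K : ClosedSubgroup G} (hH : IsFull H)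
    (h : H.conjClass = K.conjClass) : torusPart K = torusPart H := by
  obtain ⟨g, rfl⟩ := conjClass_eq_iff.1 h
  exact hH.torusPart_conjBy g

theorem ClosedSubgroup.le_of_torusPart_le {H K : ClosedSubgroup G} {g : G} (hg : g ∉ identityTorus G)
    (hgH : g ∈ H) (hgK : g ∈ K) (h : torusPart H ≤ torusPart K) : H ≤ K := by
  intro x hx
  by_cases hxT : x ∈ identityTorus G
  · exact h (x := ⟨x, hxT⟩) hx
  · have h1 := mul_mem_identityTorus_of_notMem hxT
      (fun h => hg (by simpa using inv_mem h) : g⁻¹ ∉ identityTorus G)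
    have h2 : x * g⁻¹ ∈ K := h (x := ⟨_, h1⟩) (show x * g⁻¹ ∈ H from mul_mem hx (inv_mem hgH))
    have := mul_mem h2 hgK
    rwa [inv_mul_cancel_right] at this

theorem isClosed_setOf_isFull : IsClosed {K : ClosedSubgroup G | IsFull K} := by
  have : {K : ClosedSubgroup G | IsFull K} =
      {K : ClosedSubgroup G | ((K : Set G) ∩ (identityTorus G : Set G)ᶜ).Nonempty} := by
    ext K
    exact isFull_iff
  rw [this]
  exact isClosed_setOf_inter_nonempty identityTorus_isOpen.isClosed_compl

theorem isClosed_setOf_le_torusPart (C : Subgroup (identityTorus G)) :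
    IsClosed {K : ClosedSubgroup G | C ≤ torusPart K} := by
  have : {K : ClosedSubgroup G | C ≤ torusPart K} =
      {K : ClosedSubgroup G | ((↑) '' (C : Set (identityTorus G)) : Set G) ⊆ K} := by
    ext K
    exact (Set.image_subset_iff (s := (C : Set (identityTorus G)))
      (t := (K : Set G)) (f := ((↑) : identityTorus G → G))).symm
  rw [this]
  exact isClosed_setOf_superset _

/-- Conjugation by `u ∈ 𝕋` moves `t h` to `t u / σ(u) h`. -/
theorem conj_mul_eq_skewHom {h : G} (hh : h ∉ identityTorus G) (t u : identityTorus G) :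
    (u : G) * (t * h) * (u : G)⁻¹ = (t * skewHom G u : identityTorus G) * h := by
  have h1 : h * (u⁻¹ : identityTorus G) = (torusInvolution G u⁻¹ : identityTorus G) * h :=
    mul_coe_eq_torusInvolution_mul hh _
  have h2 : t * skewHom G u = u * t * torusInvolution G u⁻¹ := by
    rw [skewHom_apply, map_inv, ← mul_assoc, mul_comm t u]
  rw [h2, Subgroup.coe_mul, Subgroup.coe_mul, mul_assoc _ _ h, ← h1]
  simp only [mul_assoc, InvMemClass.coe_inv]

theorem mul_self_eq_symmHom {h : G} (hh : h ∉ identityTorus G) (t : identityTorus G) :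
    (t * h) * (t * h) = (symmHom G t : identityTorus G) * (h * h) := by
  rw [mul_assoc, ← mul_assoc h, mul_coe_eq_torusInvolution_mul hh, symmHom_apply,
    Subgroup.coe_mul]
  simp only [mul_assoc]

theorem finite_setOf_torsion_mem {C : Subgroup (identityTorus G)} (hC : IsTorusCore C) {m : ℕ}
    (hm : m ≠ 0) {g : G} (hg : g ∉ identityTorus G) :
    {K : ClosedSubgroup G | C ≤ torusPart K ∧ (∀ s ∈ torusPart K, s ^ m ∈ C) ∧ g ∈ K}.Finite := by
  refine Set.Finite.of_finite_image (f := fun K : ClosedSubgroup G =>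
    {t : identityTorus G | t ^ m = 1 ∧ t ∈ torusPart K}) ?_ ?_
  · refine (identityTorus_finite_pow_eq_one (G := G) hm).finite_subsets.subset ?_
    rintro _ ⟨K, -, rfl⟩ t ht
    exact ht.1
  · have key : ∀ K L : ClosedSubgroup G,
        (C ≤ torusPart K ∧ (∀ s ∈ torusPart K, s ^ m ∈ C) ∧ g ∈ K) →
        (C ≤ torusPart L ∧ (∀ s ∈ torusPart L, s ^ m ∈ C) ∧ g ∈ L) →
        {t : identityTorus G | t ^ m = 1 ∧ t ∈ torusPart K} =
          {t : identityTorus G | t ^ m = 1 ∧ t ∈ torusPart L} → K ≤ L := by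
      intro K L hK hL h
      refine le_of_torusPart_le hg hK.2.2 hL.2.2 fun s hs => ?_
      obtain ⟨c, hc, r, hr, rfl⟩ := hC.exists_mul_torsion hm (hK.2.1 s hs)
      have h1 : r ∈ {t : identityTorus G | t ^ m = 1 ∧ t ∈ torusPart K} :=
        ⟨hr, (Subgroup.mul_mem_cancel_left _ (hK.1 hc)).1 hs⟩
      rw [h] at h1
      exact mul_mem (hL.1 hc) h1.2
    exact fun K hK L hL h => le_antisymm (key K L hK hL h) (key L K hL hK h.symm)

/-- There are only finitely many conjugacy classes of full subgroups `K` such that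
`(K ∩ 𝕋) / C` has exponent dividing `m`. -/
theorem finite_conjClass_of_exponent {C : Subgroup (identityTorus G)} (hC : IsTorusCore C) {m : ℕ}
    (hm : m ≠ 0) :
    (ClosedSubgroup.conjClass '' {K : ClosedSubgroup G | IsFull K ∧ C ≤ torusPart K ∧
      ∀ s ∈ torusPart K, s ^ m ∈ C}).Finite := by
  rcases Set.eq_empty_or_nonempty {K : ClosedSubgroup G | IsFull K ∧ C ≤ torusPart K ∧
      ∀ s ∈ torusPart K, s ^ m ∈ C} with he | ⟨K₀, hK₀, -, hK₀m⟩
  · rw [he, Set.image_empty]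
    exact Set.finite_empty
  obtain ⟨h, hh, hT⟩ := isFull_iff.1 hK₀
  have hmm : 2 * m ≠ 0 := mul_ne_zero two_ne_zero hm
  have hsq : (⟨h * h, mul_mem_identityTorus_of_notMem hT hT⟩ : identityTorus G) ^ m ∈ C :=
    hK₀m _ (show h * h ∈ K₀ from mul_mem hh hh)
  have hfin := (identityTorus_finite_pow_eq_one (G := G) hmm).biUnion fun r _ =>
    finite_setOf_torsion_mem hC hm (g := (r : G) * h)
      (fun hcon => hT ((Subgroup.mul_mem_cancel_left _ r.2).1 hcon))
  refine (hfin.image ClosedSubgroup.conjClass).subset ?_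
  rintro _ ⟨K, ⟨hK, hCK, hKm⟩, rfl⟩
  obtain ⟨k, hk, hkT⟩ := isFull_iff.1 hK
  obtain ⟨t, rfl⟩ : ∃ t : identityTorus G, (t : G) * h = k :=
    ⟨⟨k * h⁻¹, mul_mem_identityTorus_of_notMem hkT (fun h' => hT (by simpa using inv_mem h'))⟩,
      by simp⟩
  have h1 : symmHom G t ^ m ∈ C := by
    have h2 : symmHom G t * ⟨h * h, mul_mem_identityTorus_of_notMem hT hT⟩ ∈ torusPart K := by
      rw [mem_torusPart, Subgroup.coe_mul, ← mul_self_eq_symmHom hT]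
      exact mul_mem hk hk
    have h3 := hKm _ h2
    rw [mul_pow] at h3
    exact (Subgroup.mul_mem_cancel_right _ hsq).1 h3
  obtain ⟨d, hd, hd2⟩ := hC.exists_pow_eq hmm h1
  obtain ⟨v, hv⟩ := identityTorus_exists_pow_eq two_ne_zero t
  have hr : (t * (d * skewHom G v)⁻¹) ^ (2 * m) = 1 := by
    rw [mul_pow, inv_pow, mul_pow, hd2, pow_mul (skewHom G v), ← map_pow (skewHom G), hv,
      ← mul_pow (symmHom G t), symmHom_mul_skewHom, ← pow_mul, mul_inv_cancel]
  refine ⟨conjBy ((v⁻¹ : identityTorus G) : G) K, Set.mem_biUnion hr ⟨?_, ?_, ?_⟩, conjClass_conjBy _ _⟩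
  · rwa [hK.torusPart_conjBy]
  · rwa [hK.torusPart_conjBy]
  · have h4 : ((v⁻¹ : identityTorus G) : G) * (t * h) * ((v⁻¹ : identityTorus G) : G)⁻¹ ∈
        conjBy ((v⁻¹ : identityTorus G) : G) K := ⟨_, hk, rfl⟩
    rw [conj_mul_eq_skewHom hT] at h4
    have h5 : ((d⁻¹ : identityTorus G) : G) ∈ conjBy ((v⁻¹ : identityTorus G) : G) K := by
      rw [← mem_torusPart, hK.torusPart_conjBy]
      exact inv_mem (hCK hd)
    have h6 := mul_mem h5 h4
    rw [← mul_assoc, ← Subgroup.coe_mul] at h6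
    convert h6 using 3
    rw [mul_inv, map_inv, mul_left_comm]

theorem exists_isOpen_exponent {C : Subgroup (identityTorus G)} (hC : IsTorusCore C)
    {H : ClosedSubgroup G} (hHC : HasCore (torusPart H) C) :
    ∃ N : Set (ClosedSubgroup G), IsOpen N ∧ H ∈ N ∧
      ∃ m : ℕ, m ≠ 0 ∧ ∀ K ∈ N, ∀ s ∈ torusPart K, s ^ m ∈ C := by
  obtain ⟨-, k, hk, hS⟩ := hHC
  obtain ⟨φ, hφC, hφ⟩ := hC.exists_ker
  obtain ⟨U, hU, hsmall⟩ := identityTorus_no_small_subgroups (G := G)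
  obtain ⟨V, hVU, hV, h1V⟩ := mem_nhds_iff.1 hU
  have hO : IsOpen {t : identityTorus G | φ (t ^ k) ∈ V} :=
    hV.preimage ((map_continuous φ).comp (continuous_pow k))
  refine ⟨{K | (K : Set G) ⊆ ((↑) '' {t : identityTorus G | φ (t ^ k) ∈ V}) ∪
    (identityTorus G : Set G)ᶜ}, isOpen_setOf_subset ?_, ?_, 2 * k, mul_ne_zero two_ne_zero hk, ?_⟩
  · exact (identityTorus_isOpen.isOpenMap_subtype_val _ hO).union
      identityTorus_isClosed.isOpen_compl
  · intro x hx
    by_cases hxT : x ∈ identityTorus G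
    · refine Or.inl ⟨⟨x, hxT⟩, ?_, rfl⟩
      have := hφC _ (hS ⟨x, hxT⟩ hx)
      rw [Set.mem_ofPred_eq, this]
      exact h1V
    · exact Or.inr hxT
  · intro K hK s hs
    have h1 : ∀ t ∈ torusPart K, φ (t ^ k) ∈ V := by
      intro t ht
      rcases hK (show (t : G) ∈ K from ht) with ⟨t', ht', h⟩ | h
      · rwa [← Subtype.ext h]
      · exact absurd t.2 h
    have h2 : φ (s ^ k) = 1 := by
      refine hsmall _ fun n => hVU ?_
      rw [← map_pow, pow_right_comm]
      exact h1 _ (pow_mem hs n)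
    have := hφ _ h2
    rwa [← pow_mul, mul_comm] at this

/-- The class of a full subgroup `H` with core `C` is isolated among the full subgroups which
contain `C`. -/
theorem isClosed_setOf_conjClass_ne {C : Subgroup (identityTorus G)} (hC : IsTorusCore C)
    {H : ClosedSubgroup G} (hHC : HasCore (torusPart H) C) :
    IsClosed {K : ClosedSubgroup G | IsFull K ∧ C ≤ torusPart K ∧ K.conjClass ≠ H.conjClass} := by
  obtain ⟨N, hN, hHN, m, hm, hNm⟩ := exists_isOpen_exponent hC hHC
  have hN' : IsOpen {K : ClosedSubgroup G | ∃ g, conjBy g K ∈ N} := by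
    simp only [Set.ofPred_exists]
    exact isOpen_iUnion fun g => hN.preimage
      (continuous_conjBy.comp (Continuous.prodMk_right g))
  have hfin := (finite_conjClass_of_exponent hC hm).subset
    (Set.sdiff_subset (t := {H.conjClass}))
  have hcl := hfin.isClosed_biUnion fun x _ => isClosed_setOf_conjClass_eq x
  have hsplit := (isClosed_setOf_isFull.inter (isClosed_setOf_le_torusPart C)).inter
    (hN'.isClosed_compl.union hcl)
  convert hsplit using 1
  ext K
  constructor
  · rintro ⟨h1, h2, h3⟩
    refine ⟨⟨h1, h2⟩, ?_⟩
    by_cases hK : ∃ g, conjBy g K ∈ N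
    · obtain ⟨g, hg⟩ := hK
      refine Or.inr (Set.mem_biUnion ⟨⟨K, ⟨h1, h2, ?_⟩, rfl⟩, h3⟩ rfl)
      rw [← h1.torusPart_conjBy g]
      exact hNm _ hg
    · exact Or.inl hK
  · rintro ⟨⟨h1, h2⟩, h3 | h3⟩
    · refine ⟨h1, h2, fun hc => h3 ?_⟩
      obtain ⟨g, rfl⟩ := conjClass_eq_iff.1 hc
      exact ⟨g, hHN⟩
    · obtain ⟨x, ⟨-, hx⟩, hKx⟩ := Set.mem_iUnion₂.1 h3
      exact ⟨h1, h2, fun hc => hx (by rw [← hc]; exact hKx.symm)⟩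

end Isolated

/-! ### Approximation of full subgroups by full subgroups of smaller dimension -/

section Approximation

variable {G : Type*} [Group G] [MetricSpace G] [CompactSpace G] [IsTopologicalGroup G]
  [hG : IsRankTwoToral G]

attribute [local instance] hausdorffTopology

open ClosedSubgroup Filter

/-- The full subgroup `A ∪ A h`. -/
noncomputable def fullExtension (A : Subgroup (identityTorus G))
    (hA : IsClosed (A : Set (identityTorus G)))
    (hσ : ∀ a ∈ A, torusInvolution G a ∈ A) (h : G) (hT : h ∉ identityTorus G)
    (hsq : ∃ a ∈ A, (a : G) = h * h) : ClosedSubgroup G where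
  carrier := {x | ∃ a ∈ A, (a : G) = x ∨ (a : G) * h = x}
  one_mem' := ⟨1, one_mem A, Or.inl rfl⟩
  mul_mem' := by
    obtain ⟨s, hs, hsh⟩ := hsq
    rintro _ _ ⟨a, ha, rfl | rfl⟩ ⟨b, hb, rfl | rfl⟩
    · exact ⟨a * b, mul_mem ha hb, Or.inl rfl⟩
    · exact ⟨a * b, mul_mem ha hb, Or.inr (by rw [Subgroup.coe_mul, mul_assoc])⟩
    · refine ⟨a * torusInvolution G b, mul_mem ha (hσ b hb), Or.inr ?_⟩
      rw [Subgroup.coe_mul, mul_assoc, ← mul_coe_eq_torusInvolution_mul hT, mul_assoc]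
    · refine ⟨a * torusInvolution G b * s, mul_mem (mul_mem ha (hσ b hb)) hs, Or.inl ?_⟩
      rw [Subgroup.coe_mul, Subgroup.coe_mul, hsh, mul_assoc (a : G), ← mul_assoc _ h h,
        ← mul_coe_eq_torusInvolution_mul hT]
      simp only [mul_assoc]
  inv_mem' := by
    obtain ⟨s, hs, hsh⟩ := hsq
    rintro _ ⟨a, ha, rfl | rfl⟩
    · exact ⟨a⁻¹, inv_mem ha, Or.inl rfl⟩
    · refine ⟨s⁻¹ * torusInvolution G a⁻¹, mul_mem (inv_mem hs) (hσ _ (inv_mem ha)), Or.inr ?_⟩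
      rw [Subgroup.coe_mul, mul_assoc, ← mul_coe_eq_torusInvolution_mul hT, InvMemClass.coe_inv,
        InvMemClass.coe_inv, hsh]
      group
  isClosed' := by
    have h1 : IsCompact ((↑) '' (A : Set (identityTorus G)) : Set G) :=
      hA.isCompact.image continuous_subtype_val
    have h2 := (h1.union (h1.image (continuous_mul_const h))).isClosed
    convert h2 using 1
    ext x
    constructor
    · rintro ⟨a, ha, rfl | rfl⟩
      · exact Or.inl ⟨a, ha, rfl⟩
      · exact Or.inr ⟨a, ⟨a, ha, rfl⟩, rfl⟩
    · rintro (⟨a, ha, rfl⟩ | ⟨_, ⟨a, ha, rfl⟩, rfl⟩)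
      · exact ⟨a, ha, Or.inl rfl⟩
      · exact ⟨a, ha, Or.inr rfl⟩

section

variable {A : Subgroup (identityTorus G)} {hA : IsClosed (A : Set (identityTorus G))}
  {hσ : ∀ a ∈ A, torusInvolution G a ∈ A} {h : G} {hT : h ∉ identityTorus G}
  {hsq : ∃ a ∈ A, (a : G) = h * h}

theorem mem_fullExtension {x : G} :
    x ∈ fullExtension A hA hσ h hT hsq ↔ ∃ a ∈ A, (a : G) = x ∨ (a : G) * h = x := Iff.rfl

theorem torusPart_fullExtension : torusPart (fullExtension A hA hσ h hT hsq) = A := by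
  ext t
  rw [mem_torusPart, mem_fullExtension]
  constructor
  · rintro ⟨a, ha, hat | hat⟩
    · rwa [← Subtype.ext hat]
    · exact absurd ((Subgroup.mul_mem_cancel_left _ a.2).1 (by rw [hat]; exact t.2)) hT
  · exact fun ht => ⟨t, ht, Or.inl rfl⟩

theorem isFull_fullExtension : IsFull (fullExtension A hA hσ h hT hsq) :=
  isFull_iff.2 ⟨h, ⟨1, one_mem A, Or.inr (one_mul h)⟩, hT⟩

end

theorem HasCore.subset_closure_torsion {S C : Subgroup (identityTorus G)} (hC : IsTorusCore C)
    (h : HasCore S C) :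
    (S : Set (identityTorus G)) ⊆ closure {t | t ∈ S ∧ ∃ n : ℕ, n ≠ 0 ∧ t ^ n = 1} := by
  obtain ⟨hle, k, hk, hS⟩ := h
  intro s hs
  obtain ⟨c, hc, r, hr, rfl⟩ := hC.exists_mul_torsion hk (hS s hs)
  refine map_mem_closure (f := fun d => d * r) (continuous_mul_const r)
    (hC.subset_closure_torsion hc) ?_
  rintro d ⟨hd, n, hn, hdn⟩
  refine ⟨mul_mem (hle hd) ((Subgroup.mul_mem_cancel_left _ (hle hc)).1 hs), n * k,
    mul_ne_zero hn hk, ?_⟩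
  rw [mul_pow, pow_mul, hdn, one_pow, one_mul, mul_comm n, pow_mul, hr, one_pow]

/-- A full subgroup with a core contains elements of finite order outside of `𝕋`. -/
theorem IsFull.exists_torsion {H : ClosedSubgroup G} (hH : IsFull H)
    {C : Subgroup (identityTorus G)} (hC : IsTorusCore C) (hHC : HasCore (torusPart H) C) :
    ∃ h ∈ H, h ∉ identityTorus G ∧ ∃ s : identityTorus G, (s : G) = h * h ∧
      ∃ n : ℕ, n ≠ 0 ∧ s ^ n = 1 := by
  obtain ⟨hle, k, hk, hS⟩ := hHC
  obtain ⟨h, hh, hT⟩ := isFull_iff.1 hH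
  set s : identityTorus G := ⟨h * h, mul_mem_identityTorus_of_notMem hT hT⟩ with hs
  have hsS : s ∈ torusPart H := show h * h ∈ H from mul_mem hh hh
  have hσs : torusInvolution G s = s := by
    apply Subtype.ext
    rw [← conj_eq_torusInvolution hT]
    simp [hs, mul_assoc]
  obtain ⟨q, hq, hq4⟩ := hC.exists_pow_eq (n := 4 * k) (mul_ne_zero four_ne_zero hk)
    (inv_mem (hS s hsS))
  have hqS : symmHom G q ∈ torusPart H := hH.symmHom_mem (hle hq)
  refine ⟨symmHom G q * h, mul_mem hqS hh,
    fun hcon => hT ((Subgroup.mul_mem_cancel_left _ (symmHom G q).2).1 hcon),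
    symmHom G (symmHom G q) * s, ?_, 2 * k, mul_ne_zero two_ne_zero hk, ?_⟩
  · rw [mul_self_eq_symmHom hT, Subgroup.coe_mul]
  · have h1 : symmHom G (symmHom G q) = symmHom G q ^ 2 := by
      rw [symmHom_apply (symmHom G q), torusInvolution_symmHom, sq]
    have h2 : symmHom G s = s ^ 2 := by rw [symmHom_apply, hσs, sq]
    rw [h1, mul_pow, ← pow_mul, show 2 * (2 * k) = 4 * k by ring, ← map_pow, hq4, map_inv, map_pow,
      h2, ← pow_mul, inv_mul_cancel]

/-- The elements of `S` which are killed by `n`. -/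
noncomputable def torsionPart (S : Subgroup (identityTorus G)) (n : ℕ) :
    Subgroup (identityTorus G) :=
  S ⊓ (powMonoidHom n).ker

theorem mem_torsionPart {S : Subgroup (identityTorus G)} {n : ℕ} {t : identityTorus G} :
    t ∈ torsionPart S n ↔ t ∈ S ∧ t ^ n = 1 := Iff.rfl

theorem isClosed_sup_torsionPart {C : Subgroup (identityTorus G)} (hC : IsTorusCore C)
    (S : Subgroup (identityTorus G)) {n : ℕ} (hn : n ≠ 0) :
    IsClosed ((C ⊔ torsionPart S n : Subgroup (identityTorus G)) : Set (identityTorus G)) := by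
  have h1 : ((torsionPart S n : Subgroup (identityTorus G)) : Set (identityTorus G)).Finite :=
    (identityTorus_finite_pow_eq_one hn).subset fun t ht => ht.2
  have h2 := (hC.isClosed.isCompact.mul h1.isCompact).isClosed
  rwa [← Subgroup.mul_normal] at *

theorem exists_tendsto_of_core_le {H : ClosedSubgroup G} (hH : IsFull H)
    {C D : Subgroup (identityTorus G)} (hC : IsTorusCore C) (hHC : HasCore (torusPart H) C)
    (hD : IsTorusCore D) (hDC : D ≤ C) :
    ∃ u : ℕ → ClosedSubgroup G, (∀ n, IsFull (u n) ∧ HasCore (torusPart (u n)) D) ∧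
      Tendsto u atTop (𝓝 H) := by
  obtain ⟨h, hh, hT, s, hs, N, hN, hsN⟩ := hH.exists_torsion hC hHC
  have hsS : s ∈ torusPart H := by
    rw [mem_torusPart, hs]
    exact mul_mem hh hh
  have hne : ∀ n : ℕ, n.factorial * N ≠ 0 := fun n => mul_ne_zero n.factorial_ne_zero hN
  let A : ℕ → Subgroup (identityTorus G) := fun n => D ⊔ torsionPart (torusPart H) (n.factorial * N)
  have hσ : ∀ n, ∀ a ∈ A n, torusInvolution G a ∈ A n := by
    intro n a ha
    obtain ⟨c, hc, r, hr, rfl⟩ := Subgroup.mem_sup.1 ha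
    rw [map_mul]
    refine Subgroup.mul_mem_sup (hD.involution_mem c hc)
      (mem_torsionPart.2 ⟨hH.torusInvolution_mem hr.1, ?_⟩)
    rw [← map_pow, (mem_torsionPart.1 hr).2, map_one]
  have hsA : ∀ n, s ∈ A n := fun n => Subgroup.mem_sup_right (mem_torsionPart.2 ⟨hsS, by
    rw [mul_comm, pow_mul, hsN, one_pow]⟩)
  let u : ℕ → ClosedSubgroup G := fun n => fullExtension (A n)
    (isClosed_sup_torsionPart hD _ (hne n)) (hσ n) h hT ⟨s, hsA n, hs⟩
  have hAH : ∀ n, A n ≤ torusPart H := fun n => sup_le (hDC.trans hHC.1) inf_le_left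
  refine ⟨u, fun n => ⟨isFull_fullExtension, ?_⟩, tendsto_of_dense (fun n => ?_) ?_⟩
  · rw [torusPart_fullExtension]
    refine ⟨le_sup_left, _, hne n, fun a ha => ?_⟩
    obtain ⟨c, hc, r, hr, rfl⟩ := Subgroup.mem_sup.1 ha
    rw [mul_pow, (mem_torsionPart.1 hr).2, mul_one]
    exact pow_mem hc _
  · rintro _ ⟨a, ha, rfl | rfl⟩
    · exact hAH n ha
    · exact mul_mem (hAH n ha) hh
  · have key : ∀ V : Set (identityTorus G), IsOpen V → ∀ t ∈ torusPart H, t ∈ V →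
        ∀ᶠ n in atTop, ∃ a ∈ A n, a ∈ V := by
      intro V hV t ht htV
      obtain ⟨r, hrV, hr, m, hm, hrm⟩ :=
        mem_closure_iff.1 (hHC.subset_closure_torsion hC ht) V hV htV
      filter_upwards [eventually_ge_atTop m] with n hn
      refine ⟨r, Subgroup.mem_sup_right (mem_torsionPart.2 ⟨hr, ?_⟩), hrV⟩
      obtain ⟨j, hj⟩ := Nat.dvd_factorial (Nat.pos_of_ne_zero hm) hn
      rw [hj, mul_assoc, pow_mul, hrm, one_pow]
    rintro U hU ⟨x, hx, hxU⟩
    by_cases hxT : x ∈ identityTorus G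
    · filter_upwards [key (((↑) : identityTorus G → G) ⁻¹' U)
        (hU.preimage continuous_subtype_val) ⟨x, hxT⟩ hx hxU] with n ⟨a, ha, haU⟩
      exact ⟨a, ⟨a, ha, Or.inl rfl⟩, haU⟩
    · have h1 := mul_mem_identityTorus_of_notMem hxT
        (fun h' => hT (by simpa using inv_mem h') : h⁻¹ ∉ identityTorus G)
      filter_upwards [key ((fun t : identityTorus G => (t : G) * h) ⁻¹' U)
        (hU.preimage (by fun_prop)) ⟨_, h1⟩ (show x * h⁻¹ ∈ H from mul_mem hx (inv_mem hh))
        (by simpa using hxU)] with n ⟨a, ha, haU⟩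
      exact ⟨a * h, ⟨a, ha, Or.inr rfl⟩, haU⟩

end Approximation

/-! ### Cotoral subgroups -/

section Cotoral

variable {G : Type*} [Group G] [MetricSpace G] [CompactSpace G] [IsTopologicalGroup G]

open ClosedSubgroup

/-- `K ≤ H`, all commutators of `H` lie in `K`, and every element of `H` is for each `n ≠ 0` an
`n`-th power modulo `K`. -/
structure HasDivisibleQuotient (K H : ClosedSubgroup G) : Prop where
  le : K ≤ H
  exists_pow : ∀ n : ℕ, n ≠ 0 → ∀ x ∈ H, ∃ y ∈ H, ∃ k ∈ K, x = y ^ n * k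
  exists_comm : ∀ x ∈ H, ∀ y ∈ H, ∃ k ∈ K, x * y = y * x * k

theorem IsCotoral.hasDivisibleQuotient {K H : ClosedSubgroup G} (h : IsCotoral K H) :
    HasDivisibleQuotient K H := by
  obtain ⟨hle, hn, d, ⟨e⟩⟩ := h
  have key : ∀ x y : (H : Subgroup G),
      (QuotientGroup.mk x : (H : Subgroup G) ⧸ (K : Subgroup G).subgroupOf H) = QuotientGroup.mk y →
      ∃ k ∈ K, (y : G) = x * k := by
    intro x y hxy
    exact ⟨(x : G)⁻¹ * y, (QuotientGroup.eq (s := (K : Subgroup G).subgroupOf H)).1 hxy,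
      by rw [mul_inv_cancel_left]⟩
  refine ⟨hle, fun n hn0 x hx => ?_, fun x hx y hy => ?_⟩
  · choose r hr using fun i => Circle.exists_pow_eq hn0
      (e (QuotientGroup.mk (⟨x, hx⟩ : (H : Subgroup G))) i)
    obtain ⟨y, hy⟩ := QuotientGroup.mk_surjective (e.symm r)
    obtain ⟨k, hk, hxk⟩ := key (y ^ n) ⟨x, hx⟩ (by
      apply e.injective
      rw [QuotientGroup.mk_pow, map_pow, hy, e.apply_symm_apply]
      exact funext hr)
    exact ⟨y, y.2, k, hk, hxk⟩
  · obtain ⟨k, hk, h⟩ := key (⟨y, hy⟩ * ⟨x, hx⟩) (⟨x, hx⟩ * ⟨y, hy⟩) (by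
      apply e.injective
      rw [QuotientGroup.mk_mul, QuotientGroup.mk_mul, map_mul, map_mul, mul_comm])
    exact ⟨k, hk, h⟩

theorem HasDivisibleQuotient.conjBy {K H : ClosedSubgroup G} (h : HasDivisibleQuotient K H)
    (g : G) : HasDivisibleQuotient (conjBy g K) (conjBy g H) where
  le := by
    rintro _ ⟨x, hx, rfl⟩
    exact ⟨x, h.le hx, rfl⟩
  exists_pow := by
    rintro n hn _ ⟨x, hx, rfl⟩
    obtain ⟨y, hy, k, hk, rfl⟩ := h.exists_pow n hn x hx
    refine ⟨g * y * g⁻¹, ⟨y, hy, rfl⟩, g * k * g⁻¹, ⟨k, hk, rfl⟩, ?_⟩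
    rw [conj_pow, conj_mul]
    rfl
  exists_comm := by
    rintro _ ⟨x, hx, rfl⟩ _ ⟨y, hy, rfl⟩
    obtain ⟨k, hk, hxy⟩ := h.exists_comm x hx y hy
    refine ⟨g * k * g⁻¹, ⟨k, hk, rfl⟩, ?_⟩
    change (g * x * g⁻¹) * (g * y * g⁻¹) = (g * y * g⁻¹) * (g * x * g⁻¹) * (g * k * g⁻¹)
    rw [conj_mul, conj_mul, conj_mul, hxy]

variable [hG : IsRankTwoToral G]

/-- A power of each element of a group `H` with core `C` lies in `C`. -/
theorem HasCore.exists_pow_mem {H : ClosedSubgroup G} {C : Subgroup (identityTorus G)}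
    (h : HasCore (torusPart H) C) :
    ∃ n : ℕ, n ≠ 0 ∧ ∀ x ∈ H, ∃ c ∈ C, x ^ n = (c : G) := by
  obtain ⟨-, k, hk, hS⟩ := h
  refine ⟨2 * k, mul_ne_zero two_ne_zero hk, fun x hx => ?_⟩
  have hT : x * x ∈ identityTorus G :=
    (Subgroup.mul_mem_iff_of_index_two hG.index_eq_two).2 Iff.rfl
  refine ⟨_, hS ⟨x * x, hT⟩ (show x * x ∈ H from mul_mem hx hx), ?_⟩
  rw [pow_mul, sq]
  rfl

theorem HasDivisibleQuotient.eq_of_core_le {K H : ClosedSubgroup G} (h : HasDivisibleQuotient K H)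
    {C : Subgroup (identityTorus G)} (hC : HasCore (torusPart H) C) (hle : C ≤ torusPart K) :
    K = H := by
  obtain ⟨n, hn, hpow⟩ := hC.exists_pow_mem
  refine le_antisymm h.le fun x hx => ?_
  obtain ⟨y, hy, k, hk, rfl⟩ := h.exists_pow n hn x hx
  obtain ⟨c, hc, hcy⟩ := hpow y hy
  rw [hcy]
  exact mul_mem (hle hc) hk

theorem HasDivisibleQuotient.skewTorus_le {K H : ClosedSubgroup G} (h : HasDivisibleQuotient K H)
    (hH : IsFull H) (hle : skewTorus G ≤ torusPart H) : skewTorus G ≤ torusPart K := by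
  intro m hm
  obtain ⟨w, hw, rfl⟩ := isTorusCore_skewTorus.exists_pow_eq two_ne_zero hm
  obtain ⟨g, hg, hT⟩ := isFull_iff.1 hH
  obtain ⟨k, hk, hgk⟩ := h.exists_comm (w : G) (hle hw) g hg
  have h1 : g * (w⁻¹ : identityTorus G) = w * g := by
    rw [mul_coe_eq_torusInvolution_mul hT, torusInvolution_of_mem_skewTorus (inv_mem hw), inv_inv]
  rw [← h1, mul_assoc, mul_right_inj, InvMemClass.coe_inv, inv_eq_iff_mul_eq_one,
    ← mul_assoc, mul_eq_one_iff_eq_inv] at hgk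
  rw [mem_torusPart, Subgroup.coe_pow, sq, hgk]
  exact inv_mem hk

end Cotoral

/-! ### The Thomason filtration -/

section Thomason

theorem IsThomason.singleton {X : Type*} [TopologicalSpace X] {x : X}
    (h : IsThomason ({x} : Set X)) : IsClosed ({x} : Set X) ∧ IsCompact ({x} : Set X)ᶜ := by
  obtain ⟨C, hC, hx⟩ := h
  obtain ⟨c, hc, hxc⟩ := Set.mem_sUnion.1 (hx ▸ Set.mem_singleton x)
  have : c = {x} :=
    Set.Subset.antisymm (hx ▸ Set.subset_sUnion_of_mem hc) (Set.singleton_subset_iff.2 hxc)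
  exact this ▸ hC c hc

theorem isThomason_of_isClosed {X : Type*} [TopologicalSpace X] {A : Set X} (h : IsClosed A)
    (hc : IsCompact Aᶜ) : IsThomason A :=
  ⟨{A}, fun c hc' => by rw [Set.mem_singleton_iff.1 hc']; exact ⟨h, hc⟩,
    (Set.sUnion_singleton A).symm⟩

variable {G : Type*} [Group G] [MetricSpace G] [CompactSpace G] [IsTopologicalGroup G]
  [hG : IsRankTwoToral G]

attribute [local instance] hausdorffTopology

open ClosedSubgroup Filter

theorem FullSubgroup.conjClass_eq_iff {H K : FullSubgroup G} :
    H.conjClass = K.conjClass ↔ H.1.conjClass = K.1.conjClass := Subtype.ext_iff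

theorem FullClass.exists_rep (x : FullClass G) : ∃ H : FullSubgroup G, H.conjClass = x := by
  obtain ⟨_, H, hH, rfl⟩ := x
  exact ⟨⟨H, hH⟩, rfl⟩

theorem lieDim_eq_of_conjClass_eq {H K : ClosedSubgroup G} (hH : IsFull H)
    (h : H.conjClass = K.conjClass) : lieDim H = lieDim K :=
  lieDim_congr (hH.torusPart_eq_of_conjClass_eq h).symm

theorem hasCore_self (S : Subgroup (identityTorus G)) : HasCore S S :=
  ⟨le_rfl, 1, one_ne_zero, fun s hs => by rwa [pow_one]⟩

theorem IsMixedType.one_le_lieDim_iff (hM : IsMixedType G) {K : ClosedSubgroup G} (hK : IsFull K) :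
    1 ≤ lieDim K ↔ symmTorus G ≤ torusPart K ∨ skewTorus G ≤ torusPart K := by
  rcases hK.hasCore_cases hM with h | h | h | h
  · rw [lieDim_of_hasCore_bot h]
    refine iff_of_false (by norm_num) ?_
    obtain ⟨l, m, hl, hm, hl0, hm0, hX⟩ := hM.exists_lattice_basis
    obtain ⟨-, k, hk, hS⟩ := h
    rintro (h1 | h1)
    · have h2 : (2 * k) • LieTorus.ofLattice l = 0 := LieTorus.ext_curve fun t => by
        have := hS _ (h1 (symmHom_mem (l (Circle.exp t))))
        rw [symmHom_apply, hl, ← sq, ← pow_mul] at this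
        rw [LieTorus.curve_nsmul]
        exact this
      exact hl0 (nsmul_eq_zero_lieTorus (mul_ne_zero two_ne_zero hk) h2)
    · have h2 : (2 * k) • LieTorus.ofLattice m = 0 := LieTorus.ext_curve fun t => by
        have := hS _ (h1 (skewHom_mem (m (Circle.exp t))))
        rw [skewHom_apply, hm, inv_inv, ← sq, ← pow_mul] at this
        rw [LieTorus.curve_nsmul]
        exact this
      exact hm0 (nsmul_eq_zero_lieTorus (mul_ne_zero two_ne_zero hk) h2)
  · exact iff_of_true (lieDim_of_hasCore_symmTorus hM h).ge (Or.inl h.1)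
  · exact iff_of_true (lieDim_of_hasCore_skewTorus hM h).ge (Or.inr h.1)
  · exact iff_of_true (by rw [lieDim_of_hasCore_top h]; norm_num) (Or.inl (le_top.trans h.1))

theorem IsMixedType.two_le_lieDim_iff (hM : IsMixedType G) {K : ClosedSubgroup G} (hK : IsFull K) :
    2 ≤ lieDim K ↔ ⊤ ≤ torusPart K := by
  constructor
  · intro h2
    rcases hK.hasCore_cases hM with h | h | h | h
    · rw [lieDim_of_hasCore_bot h] at h2; omega
    · rw [lieDim_of_hasCore_symmTorus hM h] at h2; omega
    · rw [lieDim_of_hasCore_skewTorus hM h] at h2; omega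
    · exact h.1
  · intro h
    rw [lieDim_of_hasCore_top (top_le_iff.1 h ▸ hasCore_self _)]

/-- A subgroup of dimension one does not contain both circles. -/
theorem not_symmTorus_le_and_skewTorus_le {K : ClosedSubgroup G}
    (h : lieDim K = 1) (h1 : symmTorus G ≤ torusPart K) (h2 : skewTorus G ≤ torusPart K) :
    False := by
  have h3 : HasCore (torusPart K) ⊤ := by
    rw [eq_top_of_symmTorus_le_of_skewTorus_le h1 h2]
    exact hasCore_self _
  rw [lieDim_of_hasCore_top h3] at h
  omega

/-- A full subgroup `H` has a core `C` contained in all full subgroups of `H` of the same dimension,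
and the class of `H` is isolated among the full subgroups of at least its dimension. -/
theorem IsMixedType.exists_core (hM : IsMixedType G) {H : ClosedSubgroup G} (hH : IsFull H) :
    ∃ C : Subgroup (identityTorus G), IsTorusCore C ∧ HasCore (torusPart H) C ∧
      (∀ K : ClosedSubgroup G, IsFull K → torusPart K ≤ torusPart H → lieDim H ≤ lieDim K →
        C ≤ torusPart K) ∧
      IsClosed {K : ClosedSubgroup G | IsFull K ∧ lieDim H ≤ lieDim K ∧
        K.conjClass ≠ H.conjClass} := by
  rcases hH.hasCore_cases hM with h | h | h | h
  · refine ⟨⊥, isTorusCore_bot, h, fun _ _ _ _ => bot_le, ?_⟩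
    convert isClosed_setOf_conjClass_ne isTorusCore_bot h using 4
    rw [lieDim_of_hasCore_bot h]
    simp
  · have hd := lieDim_of_hasCore_symmTorus hM h
    refine ⟨_, isTorusCore_symmTorus, h, fun K hK hKH hle => ?_, ?_⟩
    · rw [hd] at hle
      refine ((hM.one_le_lieDim_iff hK).1 hle).resolve_right fun h2 => ?_
      exact not_symmTorus_le_and_skewTorus_le hd h.1 (h2.trans hKH)
    · convert (isClosed_setOf_conjClass_ne isTorusCore_symmTorus h).union
        (isClosed_setOf_isFull.inter (isClosed_setOf_le_torusPart (skewTorus G))) using 1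
      ext K
      constructor
      · rintro ⟨h1, h2, h3⟩
        rw [hd] at h2
        exact ((hM.one_le_lieDim_iff h1).1 h2).imp (fun h4 => ⟨h1, h4, h3⟩) fun h4 => ⟨h1, h4⟩
      · rintro (⟨h1, h2, h3⟩ | ⟨h1, h2⟩)
        · exact ⟨h1, hd ▸ (hM.one_le_lieDim_iff h1).2 (Or.inl h2), h3⟩
        · refine ⟨h1, hd ▸ (hM.one_le_lieDim_iff h1).2 (Or.inr h2), fun hc => ?_⟩
          rw [Set.mem_ofPred_eq, ← h1.torusPart_eq_of_conjClass_eq hc] at h2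
          exact not_symmTorus_le_and_skewTorus_le hd h.1 h2
  · have hd := lieDim_of_hasCore_skewTorus hM h
    refine ⟨_, isTorusCore_skewTorus, h, fun K hK hKH hle => ?_, ?_⟩
    · rw [hd] at hle
      refine ((hM.one_le_lieDim_iff hK).1 hle).resolve_left fun h2 => ?_
      exact not_symmTorus_le_and_skewTorus_le hd (h2.trans hKH) h.1
    · convert (isClosed_setOf_conjClass_ne isTorusCore_skewTorus h).union
        (isClosed_setOf_isFull.inter (isClosed_setOf_le_torusPart (symmTorus G))) using 1
      ext K
      constructor
      · rintro ⟨h1, h2, h3⟩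
        rw [hd] at h2
        exact ((hM.one_le_lieDim_iff h1).1 h2).symm.imp (fun h4 => ⟨h1, h4, h3⟩)
          fun h4 => ⟨h1, h4⟩
      · rintro (⟨h1, h2, h3⟩ | ⟨h1, h2⟩)
        · exact ⟨h1, hd ▸ (hM.one_le_lieDim_iff h1).2 (Or.inr h2), h3⟩
        · refine ⟨h1, hd ▸ (hM.one_le_lieDim_iff h1).2 (Or.inl h2), fun hc => ?_⟩
          rw [Set.mem_ofPred_eq, ← h1.torusPart_eq_of_conjClass_eq hc] at h2
          exact not_symmTorus_le_and_skewTorus_le hd h2 h.1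
  · have hd := lieDim_of_hasCore_top h
    refine ⟨⊤, isTorusCore_top, h, fun K hK _ hle => ?_, ?_⟩
    · exact (hM.two_le_lieDim_iff hK).1 (hd ▸ hle)
    · convert isClosed_setOf_conjClass_ne isTorusCore_top h using 1
      ext K
      refine and_congr_right fun hK => and_congr_left fun _ => ?_
      rw [hd]
      exact hM.two_le_lieDim_iff hK

/-- The classes of closed subgroups `K ≤ H` with `K C = H` form a Zariski closed set. -/
theorem isClosed_setOf_mul_core_eq {H : ClosedSubgroup G} {C : Subgroup (identityTorus G)}
    (hC : IsTorusCore C) (hHC : HasCore (torusPart H) C) :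
    IsClosed (ClosedSubgroup.conjClass '' {K : ClosedSubgroup G | K ≤ H ∧
      ∀ x ∈ H, ∃ c ∈ C, (c : G) * x ∈ K}) := by
  obtain ⟨n, hn, hpow⟩ := hHC.exists_pow_mem
  refine isClosed_zariski_iff.2 ⟨isClosed_hTopology_iff.1 (isClosed_hTopology_image ?_), ?_⟩
  · have h1 : IsClosed {K : ClosedSubgroup G | K ≤ H} := isClosed_setOf_subset H.isClosed'
    have h2 : ∀ x ∈ H, IsClosed {K : ClosedSubgroup G | ((K : Set G) ∩
        ((fun c : identityTorus G => (c : G) * x) '' C)).Nonempty} := fun x _ =>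
      isClosed_setOf_inter_nonempty
        (hC.isClosed.isCompact.image (by fun_prop)).isClosed
    convert h1.inter (isClosed_biInter h2) using 1
    ext K
    refine and_congr_right fun _ => ?_
    simp only [Set.mem_iInter]
    refine forall₂_congr fun x _ => ⟨?_, ?_⟩
    · rintro ⟨c, hc, hcx⟩
      exact ⟨_, hcx, c, hc, rfl⟩
    · rintro ⟨_, hcx, c, hc, rfl⟩
      exact ⟨c, hc, hcx⟩
  · rintro _ _ ⟨K, L', rfl, rfl, hKL⟩ ⟨L, ⟨hLH, hL⟩, hLL⟩
    obtain ⟨g, rfl⟩ := conjClass_eq_iff.1 hLL.symm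
    have hq := hKL.hasDivisibleQuotient.conjBy g
    refine ⟨conjBy g K, ⟨hq.le.trans hLH, fun x hx => ?_⟩, conjClass_conjBy _ _⟩
    obtain ⟨c, hc, hcx⟩ := hL x hx
    obtain ⟨y, hy, k, hk, hxk⟩ := hq.exists_pow n hn _ hcx
    obtain ⟨d, hd, hdy⟩ := hpow y (hLH hy)
    refine ⟨d⁻¹ * c, mul_mem (inv_mem hd) hc, ?_⟩
    rw [Subgroup.coe_mul, mul_assoc, hxk, hdy, InvMemClass.coe_inv, inv_mul_cancel_left]
    exact hk

/-- A full subgroup with core `C` has no proper cotoral subgroups if `C` is trivial or is the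
circle on which `W` acts by inversion. -/
theorem IsFull.eq_of_isCotoralClass {L : ClosedSubgroup G} (hL : IsFull L)
    {D : Subgroup (identityTorus G)} (hLD : HasCore (torusPart L) D)
    (hD : D = ⊥ ∨ D = skewTorus G) {x : ConjClassSpace G} (h : IsCotoralClass x L.conjClass) :
    x = L.conjClass := by
  obtain ⟨K, L', rfl, hL', hKL⟩ := h
  have h1 := hL.of_conjClass_eq hL'.symm
  rw [← hL.torusPart_eq_of_conjClass_eq hL'.symm] at hLD
  rw [← hL', hKL.hasDivisibleQuotient.eq_of_core_le hLD ?_]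
  rcases hD with rfl | rfl
  · exact bot_le
  · exact hKL.hasDivisibleQuotient.skewTorus_le h1 hLD.1

variable {n : ℕ} {V : Set (FullClass G)}

theorem IsMixedType.isThomason_singleton (hM : IsMixedType G)
    (hV : ∀ H : FullSubgroup G, H.conjClass ∈ V ↔ n ≤ lieDim H.1) {H : FullSubgroup G}
    (hH : lieDim H.1 = n) (hx : H.conjClass ∈ V) :
    IsThomason ({⟨H.conjClass, hx⟩} : Set V) := by
  obtain ⟨C, hC, hHC, hle, hcl⟩ := hM.exists_core H.2
  have hind : Topology.IsInducing fun v : V => ((v : FullClass G) : ConjClassSpace G) :=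
    Topology.IsInducing.subtypeVal.comp Topology.IsInducing.subtypeVal
  refine isThomason_of_isClosed ?_ (hind.isCompact_iff.2 ?_)
  · convert (isClosed_setOf_mul_core_eq hC hHC).preimage hind.continuous using 1
    ext ⟨v, hv⟩
    obtain ⟨K, rfl⟩ := v.exists_rep
    rw [Set.mem_singleton_iff, Subtype.mk.injEq, FullSubgroup.conjClass_eq_iff]
    constructor
    · intro h
      exact ⟨H.1, ⟨le_rfl, fun x hx => ⟨1, one_mem C, by simpa using hx⟩⟩, h.symm⟩
    · rintro ⟨L, ⟨hLH, hL⟩, hLK⟩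
      have hLf := K.2.of_conjClass_eq hLK.symm
      have hdim : lieDim H.1 ≤ lieDim L := by
        rw [lieDim_eq_of_conjClass_eq hLf hLK, hH]
        exact (hV K).1 hv
      have hCL := hle L hLf (fun t ht => hLH ht) hdim
      have : L = H.1 := le_antisymm hLH fun x hx => by
        obtain ⟨c, hc, hcx⟩ := hL x hx
        have := mul_mem (inv_mem (show (c : G) ∈ L from hCL hc)) hcx
        rwa [inv_mul_cancel_left] at this
      rw [← this]
      exact hLK.symm
  · convert hcl.isCompact.image continuous_conjClass using 1
    ext x
    constructor
    · rintro ⟨⟨v, hv⟩, hvx, rfl⟩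
      obtain ⟨K, rfl⟩ := v.exists_rep
      refine ⟨K.1, ⟨K.2, by rw [hH]; exact (hV K).1 hv, fun hc => hvx ?_⟩, rfl⟩
      exact Subtype.ext (FullSubgroup.conjClass_eq_iff.2 hc)
    · rintro ⟨K, ⟨hK, hdim, hne⟩, rfl⟩
      refine ⟨⟨FullSubgroup.conjClass ⟨K, hK⟩, (hV _).2 (by rw [← hH]; exact hdim)⟩, fun hc => ?_,
        rfl⟩
      exact hne (FullSubgroup.conjClass_eq_iff.1 (congrArg Subtype.val hc))

theorem not_isThomason_of_tendsto
    (hV : ∀ H : FullSubgroup G, H.conjClass ∈ V ↔ n ≤ lieDim H.1) {H : FullSubgroup G}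
    (hH : n < lieDim H.1) (hx : H.conjClass ∈ V) {u : ℕ → ClosedSubgroup G}
    (hu : Tendsto u atTop (𝓝 H.1)) (hfull : ∀ i, IsFull (u i)) (hdim : ∀ i, lieDim (u i) = n)
    (hcot : ∀ i x, IsCotoralClass x (u i).conjClass → x = (u i).conjClass) :
    ¬ IsThomason ({⟨H.conjClass, hx⟩} : Set V) := by
  intro hT
  obtain ⟨hcl, hcpt⟩ := hT.singleton
  have hind : Topology.IsInducing fun v : V => ((v : FullClass G) : ConjClassSpace G) :=
    Topology.IsInducing.subtypeVal.comp Topology.IsInducing.subtypeVal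
  obtain ⟨A, hA, hAx⟩ := hind.isClosed_iff.1 hcl
  have hHA : H.1.conjClass ∈ A := by
    have : (⟨H.conjClass, hx⟩ : V) ∈ ({⟨H.conjClass, hx⟩} : Set V) := rfl
    rw [← hAx] at this
    exact this
  let B : ℕ → Set (ConjClassSpace G) := fun m =>
    A ∪ ClosedSubgroup.conjClass '' (insert H.1 (Set.range fun i => u (i + m)))
  have hB : ∀ m, IsClosed (B m) := by
    intro m
    have hA' := isClosed_zariski_iff.1 hA
    refine isClosed_zariski_iff.2 ⟨hA'.1.union (isClosed_hTopology_iff.1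
      (isClosed_hTopology_image ((tendsto_add_atTop_iff_nat m).2 hu).isCompact_insert_range.isClosed)),
      ?_⟩
    rintro x y hxy (hy | ⟨K, rfl | ⟨i, rfl⟩, rfl⟩)
    · exact Or.inl (hA'.2 x y hxy hy)
    · exact Or.inl (hA'.2 x _ hxy hHA)
    · rw [hcot _ x hxy]
      exact Or.inr ⟨_, Or.inr ⟨i, rfl⟩, rfl⟩
  let O : ℕ → Set V := fun m => {v : V | ((v : FullClass G) : ConjClassSpace G) ∉ B m}
  have hcov : ({⟨H.conjClass, hx⟩} : Set V)ᶜ ⊆ ⋃ m, O m := by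
    rintro ⟨v, hv⟩ hvx
    obtain ⟨K, rfl⟩ := v.exists_rep
    have hne : H.1.conjClass ≠ K.1.conjClass := fun hc =>
      hvx (Subtype.ext (FullSubgroup.conjClass_eq_iff.2 hc.symm))
    have hev := hu.eventually
      ((isClosed_setOf_conjClass_eq K.1.conjClass).isOpen_compl.mem_nhds hne)
    obtain ⟨m, hm⟩ := eventually_atTop.1 hev
    refine Set.mem_iUnion.2 ⟨m, ?_⟩
    rintro (hKA | ⟨L, rfl | ⟨i, rfl⟩, hL⟩)
    · have : (⟨K.conjClass, hv⟩ : V) ∈ ({⟨H.conjClass, hx⟩} : Set V) := by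
        rw [← hAx]
        exact hKA
      exact hvx this
    · exact hne hL
    · exact hm (i + m) (Nat.le_add_left m i) hL
  have hdir : Directed (· ⊆ ·) O := by
    refine directed_of_isDirected_le fun a b hab v hv hvB => hv ?_
    refine hvB.imp_right ?_
    rintro ⟨L, rfl | ⟨i, rfl⟩, hL⟩
    · exact ⟨_, Or.inl rfl, hL⟩
    · exact ⟨_, Or.inr ⟨i + (b - a), by
        simp only
        congr 1
        omega⟩, hL⟩
  obtain ⟨m, hm⟩ := hcpt.elim_directed_cover O
    (fun m => ((hB m).preimage hind.continuous).isOpen_compl) hcov hdir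
  have hmem : FullSubgroup.conjClass ⟨u m, hfull m⟩ ∈ V := (hV _).2 (hdim m).ge
  have hne : (⟨_, hmem⟩ : V) ∈ ({⟨H.conjClass, hx⟩} : Set V)ᶜ := by
    intro hc
    have h1 := FullSubgroup.conjClass_eq_iff.1 (congrArg Subtype.val hc)
    have h2 := lieDim_eq_of_conjClass_eq (hfull m) h1
    rw [hdim] at h2
    omega
  exact hm hne (Or.inr ⟨u m, Or.inr ⟨0, by simp⟩, rfl⟩)

theorem IsMixedType.not_isThomason_singleton (hM : IsMixedType G)
    (hV : ∀ H : FullSubgroup G, H.conjClass ∈ V ↔ n ≤ lieDim H.1) {H : FullSubgroup G}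
    (hH : n < lieDim H.1) (hx : H.conjClass ∈ V) :
    ¬ IsThomason ({⟨H.conjClass, hx⟩} : Set V) := by
  obtain ⟨C, hC, hHC, -, -⟩ := hM.exists_core H.2
  obtain ⟨D, hD, hD', hDC, hDn⟩ : ∃ D : Subgroup (identityTorus G), IsTorusCore D ∧
      (D = ⊥ ∨ D = skewTorus G) ∧ D ≤ C ∧
      ∀ K : ClosedSubgroup G, HasCore (torusPart K) D → lieDim K = n := by
    have h2 : lieDim H.1 ≤ 2 := by
      rw [← LieTorus.finrank_eq_two G]
      exact Submodule.finrank_le _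
    rcases Nat.eq_zero_or_pos n with rfl | hn
    · exact ⟨⊥, isTorusCore_bot, Or.inl rfl, bot_le, fun K hK => lieDim_of_hasCore_bot hK⟩
    · obtain rfl : n = 1 := by omega
      refine ⟨skewTorus G, isTorusCore_skewTorus, Or.inr rfl, ?_,
        fun K hK => lieDim_of_hasCore_skewTorus hM hK⟩
      obtain ⟨-, k, hk, hS⟩ := hHC
      exact isTorusCore_skewTorus.le_of_pow_mem hk fun c hc =>
        hS c ((hM.two_le_lieDim_iff H.2).1 hH trivial)
  obtain ⟨u, hu, hlim⟩ := exists_tendsto_of_core_le H.2 hC hHC hD hDC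
  refine not_isThomason_of_tendsto hV hH hx hlim (fun i => (hu i).1) (fun i => hDn _ (hu i).2)
    fun i x hxi => (hu i).1.eq_of_isCotoralClass (hu i).2 hD' hxi

theorem IsMixedType.mem_thomasonRemainder_iff (hM : IsMixedType G) (n : ℕ) :
    ∀ H : FullSubgroup G, H.conjClass ∈ thomasonRemainder (FullClass G) n ↔ n ≤ lieDim H.1 := by
  induction n with
  | zero => exact fun H => iff_of_true trivial (Nat.zero_le _)
  | succ n ih =>
    intro H
    constructor
    · rintro ⟨hx, hT⟩
      exact lt_of_le_of_ne ((ih H).1 hx) fun h => hT (hM.isThomason_singleton ih h.symm hx)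
    · intro h
      have hx := (ih H).2 (Nat.le_of_succ_le h)
      exact ⟨hx, hM.not_isThomason_singleton ih h hx⟩

theorem IsMixedType.height_eq (hM : IsMixedType G) (H : FullSubgroup G) :
    H.height = (lieDim H.1 : ℕ∞) := by
  refine le_antisymm ?_ (le_iInf fun ⟨m, hm⟩ => ?_)
  · exact iInf_le_of_le ⟨lieDim H.1, by rw [hM.mem_thomasonRemainder_iff]; omega⟩ le_rfl
  · rw [hM.mem_thomasonRemainder_iff] at hm
    exact_mod_cast (by omega : lieDim H.1 ≤ m)

end Thomason

/-! ### Weyl groups and the subgroups of height one -/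

section Weyl

variable {G : Type*} [Group G] [MetricSpace G] [CompactSpace G] [IsTopologicalGroup G]
  [hG : IsRankTwoToral G]

open ClosedSubgroup

theorem map_subtype_le_iff {C : Subgroup (identityTorus G)} {H : ClosedSubgroup G} :
    C.map (identityTorus G).subtype ≤ (H : Subgroup G) ↔ C ≤ torusPart H :=
  Subgroup.map_le_iff_le_comap

theorem circleZ_le_iff {H : ClosedSubgroup G} :
    circleZ G ≤ (H : Subgroup G) ↔ symmTorus G ≤ torusPart H := by
  rw [circleZ_eq_map, map_subtype_le_iff]

theorem circleTilde_le_iff {H : ClosedSubgroup G} :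
    circleTilde G ≤ (H : Subgroup G) ↔ skewTorus G ≤ torusPart H := by
  rw [circleTilde_eq_map, map_subtype_le_iff]

theorem IsFull.top_le_iff {H : ClosedSubgroup G} (hH : IsFull H) :
    ⊤ ≤ (H : Subgroup G) ↔ ⊤ ≤ torusPart H :=
  ⟨fun h _ _ => h trivial, fun h => (hH.eq_top (_root_.top_le_iff.1 h)).ge⟩

theorem commute_of_mem_symmTorus {z : identityTorus G} (hz : z ∈ symmTorus G) (g : G) :
    g * z = z * g := by
  by_cases hg : g ∈ identityTorus G
  · exact congrArg Subtype.val (mul_comm (⟨g, hg⟩ : identityTorus G) z)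
  · rw [mul_coe_eq_torusInvolution_mul hg, torusInvolution_of_mem_symmTorus hz]

theorem symmTorus_le_of_finite_weylGroup {H : ClosedSubgroup G}
    (h : Finite (WeylGroup (H : Subgroup G))) : symmTorus G ≤ torusPart H := by
  refine isTorusCore_symmTorus.le_of_pow_mem (n := Nat.card (WeylGroup (H : Subgroup G)))
    Nat.card_pos.ne' fun z hz => ?_
  have hN : (z : G) ∈ Subgroup.normalizer ((H : Subgroup G) : Set G) := by
    rw [Subgroup.mem_normalizer_iff]
    intro g
    rw [← commute_of_mem_symmTorus hz, mul_inv_cancel_right]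
  have h1 := pow_card_eq_one' (x := (QuotientGroup.mk ⟨(z : G), hN⟩ : WeylGroup (H : Subgroup G)))
  rw [← QuotientGroup.mk_pow, QuotientGroup.eq_one_iff] at h1
  exact h1

theorem IsFull.exists_mul_torsion_of_skewHom_mem (hM : IsMixedType G) {H : ClosedSubgroup G}
    (hH : IsFull H) (hle : symmTorus G ≤ torusPart H) :
    ∃ k : ℕ, k ≠ 0 ∧ ∀ t, skewHom G t ∈ torusPart H →
      ∃ s ∈ torusPart H, ∃ r : identityTorus G, r ^ k = 1 ∧ t = s * r := by
  have key : (∃ k : ℕ, k ≠ 0 ∧ ∀ s ∈ torusPart H, s ^ k ∈ symmTorus G) ∨ torusPart H = ⊤ := by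
    rcases hH.hasCore_cases hM with h | h | h | h
    · obtain ⟨-, k, hk, hS⟩ := h
      exact Or.inl ⟨k, hk, fun s hs => by rw [(hS s hs : s ^ k = 1)]; exact one_mem _⟩
    · exact Or.inl h.2
    · exact Or.inr (eq_top_of_symmTorus_le_of_skewTorus_le hle h.1)
    · exact Or.inr (_root_.top_le_iff.1 h.1)
  rcases key with ⟨k, hk, hS⟩ | htop
  · refine ⟨2 * k, mul_ne_zero two_ne_zero hk, fun t ht => ?_⟩
    have h1 : t ^ (2 * k) ∈ symmTorus G := by
      rw [pow_mul, ← symmHom_mul_skewHom]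
      exact hS _ (mul_mem (hle (_root_.symmHom_mem t)) ht)
    obtain ⟨c, hc, r, hr, h⟩ :=
      isTorusCore_symmTorus.exists_mul_torsion (mul_ne_zero two_ne_zero hk) h1
    exact ⟨c, hle hc, r, hr, h⟩
  · exact ⟨1, one_ne_zero, fun t _ => ⟨t, htop ▸ trivial, 1, one_pow _, (mul_one t).symm⟩⟩

theorem IsFull.finite_weylGroup (hM : IsMixedType G) {H : ClosedSubgroup G} (hH : IsFull H)
    (hle : symmTorus G ≤ torusPart H) : Finite (WeylGroup (H : Subgroup G)) := by
  obtain ⟨k, hk, hskew⟩ := hH.exists_mul_torsion_of_skewHom_mem hM hle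
  obtain ⟨h, hh, hT⟩ := isFull_iff.1 hH
  set N := Subgroup.normalizer ((H : Subgroup G) : Set G) with hNdef
  have hHN : (H : Subgroup G) ≤ N := Subgroup.le_normalizer
  have hfin : {x : N | ∃ r : identityTorus G, r ^ k = 1 ∧ (r : G) = x}.Finite := by
    refine Set.Finite.of_finite_image (f := ((↑) : N → G)) ?_ Subtype.val_injective.injOn
    refine ((identityTorus_finite_pow_eq_one (G := G) hk).image ((↑) : identityTorus G → G)).subset ?_
    rintro _ ⟨x, ⟨r, hr, hrx⟩, rfl⟩
    exact ⟨r, hr, hrx⟩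
  refine Set.finite_univ_iff.1 ((hfin.image
    (QuotientGroup.mk : N → WeylGroup (H : Subgroup G))).subset fun q _ => ?_)
  obtain ⟨n, rfl⟩ := QuotientGroup.mk_surjective q
  obtain ⟨t, g, hg, hn⟩ : ∃ t : identityTorus G, ∃ g ∈ H, (n : G) = t * g := by
    by_cases hnT : (n : G) ∈ identityTorus G
    · exact ⟨⟨n, hnT⟩, 1, one_mem H, (mul_one _).symm⟩
    · exact ⟨⟨n * h⁻¹, mul_mem_identityTorus_of_notMem hnT
        (fun h' => hT (by simpa using inv_mem h'))⟩, h, hh, by simp⟩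
  have htN : (t : G) ∈ N := by
    rw [eq_mul_inv_of_mul_eq hn.symm]
    exact mul_mem n.2 (inv_mem (hHN hg))
  have h1 : skewHom G t ∈ torusPart H := by
    have h2 : (t : G) * h * (t : G)⁻¹ ∈ H := (Subgroup.mem_normalizer_iff.1 htN h).1 hh
    have h3 := conj_mul_eq_skewHom hT 1 t
    rw [Subgroup.coe_one, one_mul, one_mul] at h3
    rw [h3] at h2
    have := mul_mem h2 (inv_mem hh)
    rwa [mul_inv_cancel_right] at this
  obtain ⟨s, hs, r, hr, rfl⟩ := hskew t h1
  have hrN : (r : G) ∈ N := by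
    have := mul_mem (inv_mem (hHN (show (s : G) ∈ H from hs))) htN
    rwa [Subgroup.coe_mul, inv_mul_cancel_left] at this
  refine ⟨⟨r, hrN⟩, ⟨r, hr, rfl⟩, QuotientGroup.eq.2 ?_⟩
  rw [Subgroup.mem_subgroupOf]
  change (r : G)⁻¹ * n ∈ H
  rw [hn, mul_comm s r, Subgroup.coe_mul, mul_assoc, inv_mul_cancel_left]
  exact mul_mem (show (s : G) ∈ H from hs) hg

/-- There are full subgroups of dimension one containing either of the two circles. -/
theorem exists_isFull_hasCore {D : Subgroup (identityTorus G)} (hD : IsTorusCore D) :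
    ∃ H : FullSubgroup G, HasCore (torusPart H.1) D := by
  let T : ClosedSubgroup G := ⟨⊤, isClosed_univ⟩
  obtain ⟨g, hg⟩ := exists_notMem_identityTorus G
  have hT : IsFull T := isFull_iff.2 ⟨g, trivial, hg⟩
  have hc : HasCore (torusPart T) ⊤ := ⟨fun _ _ => trivial, 1, one_ne_zero, fun _ _ => trivial⟩
  obtain ⟨u, hu, -⟩ := exists_tendsto_of_core_le hT isTorusCore_top hc hD le_top
  exact ⟨⟨u 0, (hu 0).1⟩, (hu 0).2⟩

theorem IsMixedType.mem_upSet_diff_of_lieDim_eq_one (hM : IsMixedType G) {K : Subgroup G}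
    {H : FullSubgroup G} (hK : K ≤ (H.1 : Subgroup G)) (hd : lieDim H.1 = 1) :
    H ∈ upSet K \ upSet ⊤ := by
  refine ⟨hK, fun htop => ?_⟩
  have := (hM.two_le_lieDim_iff H.2).2 (H.2.top_le_iff.1 htop)
  omega

end Weyl

theorem mainTheorem5 {G : Type*} [Group G] [MetricSpace G] [IsTopologicalGroup G] [CompactSpace G]
    [IsRankTwoToral G] (hG : IsMixedType G) :
    (∀ H : FullSubgroup G, H.height = (lieDim H.1 : ℕ∞)) ∧
    (∀ H : FullSubgroup G, Finite (WeylGroup (H.1 : Subgroup G)) ↔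
      circleZ G ≤ (H.1 : Subgroup G)) ∧
    ({H : FullSubgroup G | H.height = 1} =
        (upSet (circleZ G) \ upSet ⊤) ∪ (upSet (circleTilde G) \ upSet ⊤) ∧
      Disjoint (upSet (circleZ G) \ upSet (⊤ : Subgroup G))
        (upSet (circleTilde G) \ upSet (⊤ : Subgroup G)) ∧
      (upSet (circleZ G) \ upSet (⊤ : Subgroup G)).Nonempty ∧
      (upSet (circleTilde G) \ upSet (⊤ : Subgroup G)).Nonempty) := by
  refine ⟨hG.height_eq, fun H => ⟨fun h => circleZ_le_iff.2 (symmTorus_le_of_finite_weylGroup h),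
    fun h => H.2.finite_weylGroup hG (circleZ_le_iff.1 h)⟩, ?_, ?_, ?_, ?_⟩
  · ext H
    rw [Set.mem_ofPred_eq, hG.height_eq, Nat.cast_eq_one]
    constructor
    · intro h
      exact ((hG.one_le_lieDim_iff H.2).1 h.ge).imp
        (fun h1 => hG.mem_upSet_diff_of_lieDim_eq_one (circleZ_le_iff.2 h1) h)
        (fun h1 => hG.mem_upSet_diff_of_lieDim_eq_one (circleTilde_le_iff.2 h1) h)
    · intro h
      have h1 : symmTorus G ≤ torusPart H.1 ∨ skewTorus G ≤ torusPart H.1 :=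
        h.imp (fun h => circleZ_le_iff.1 h.1) (fun h => circleTilde_le_iff.1 h.1)
      have h2 : ¬ 2 ≤ lieDim H.1 := fun h2 =>
        (h.elim And.right And.right) (H.2.top_le_iff.2 ((hG.two_le_lieDim_iff H.2).1 h2))
      have := (hG.one_le_lieDim_iff H.2).2 h1
      omega
  · rw [Set.disjoint_left]
    rintro H ⟨h1, h2⟩ ⟨h3, -⟩
    exact h2 (H.2.top_le_iff.2 (eq_top_of_symmTorus_le_of_skewTorus_le (circleZ_le_iff.1 h1)
      (circleTilde_le_iff.1 h3)).ge)
  · obtain ⟨H, hH⟩ := exists_isFull_hasCore (G := G) isTorusCore_symmTorus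
    exact ⟨H, hG.mem_upSet_diff_of_lieDim_eq_one (circleZ_le_iff.2 hH.1)
      (lieDim_of_hasCore_symmTorus hG hH)⟩
  · obtain ⟨H, hH⟩ := exists_isFull_hasCore (G := G) isTorusCore_skewTorus
    exact ⟨H, hG.mem_upSet_diff_of_lieDim_eq_one (circleTilde_le_iff.2 hH.1)
      (lieDim_of_hasCore_skewTorus hG hH)⟩
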